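/- Let $d\in\mathbb N_0$, let $\Omega\subset\mathbb R^d$ be open and bounded, and let $L^2(\Omega)$ be the space of complex-valued square integrable functions with respect to Lebesgue measure. Let $H^1(\Omega)$ be the space of all $u\in L^2(\Omega)$ with weak gradient $\nabla u\in L^2(\Omega)^d$, with its usual norm, and let $C(\overline\Omega)\cap H^1(\Omega)$ be the subspace of those $u\in H^1(\Omega)$ that have a representative which is continuous on $\overline\Omega$. For a set $T\subset H^1(\Omega)$ define the operator $\Delta_T$ in $L^2(\Omega)$ by $$D(\Delta_T)=\Bigl\{u\in H^1(\Omega):\ \Delta u\in L^2(\Omega),\ \int_\Omega(\Delta u)\,\overline v+\int_\Omega\nabla u\cdot\overline{\nabla v}=0\ \text{ for all } v\in T\Bigr\},\qquad \Delta_T u=\Delta u,$$ where $\Delta u$ is the distributional Laplacian; the integral condition expresses $\partial_\nu u=0$ weakly, via Green's formula tested against $T$. The Neumann Laplacian is $\Delta^{\mathrm N}:=\Delta_{H^1(\Omega)}$. A $C_0$-semigroup $(S(t))_{t\ge0}$ on $L^2(\Omega)$ is called submarkovian if it is positive ($f\ge0$ a.e. implies $S(t)f\ge0$ a.e., for all $t>0$)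 and $L^\infty$-contractive ($\|S(t)f\|_{L^\infty(\Omega)}\le\|f\|_{L^\infty(\Omega)}$ for all $f\in L^\infty(\Omega)$, $t>0$). 1. The operator $\Delta^{\mathrm N}$ is the generator of a submarkovian $C_0$-semigroup on $L^2(\Omega)$. 2. If $C(\overline\Omega)\cap H^1(\Omega)$ is dense in $H^1(\Omega)$, then the operator $\Delta_{C(\overline\Omega)\cap H^1(\Omega)}$, for which Green's formula is tested only against $C(\overline\Omega)\cap H^1(\Omega)$, is the generator of a submarkovian $C_0$-semigroup on $L^2(\Omega)$. -/

import Mathlib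

open MeasureTheory Filter Topology TopologicalSpace
open scoped NNReal ENNReal ComplexConjugate Distributions LineDeriv

noncomputable section

namespace NeumannLap

/-! ### Semigroups and their generators -/

section Semigroup

variable {H : Type*} [NormedAddCommGroup H] [NormedSpace ℂ H]

/-- `(S(t))_{t ≥ 0}` is a `C₀`-semigroup of bounded operators on `H`. -/
structure IsC0Semigroup (S : ℝ≥0 → H →L[ℂ] H) : Prop where
  zero : S 0 = ContinuousLinearMap.id ℂ H
  add : ∀ s t : ℝ≥0, S (s + t) = (S s).comp (S t)
  strongly_continuous : ∀ f : H, Tendsto (fun t => S t f) (𝓝[>] 0) (𝓝 f)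

/-- The (unbounded) operator with graph `A` is the generator of the semigroup `S`: the pair
`(u, f)` lies in the graph exactly if the difference quotients `(S(t)u - u)/t` converge to `f` as
`t ↓ 0`. In particular the domain of the operator is the set of *all* `u` for which this limit
exists. -/
def IsGenerator (A : Set (H × H)) (S : ℝ≥0 → H →L[ℂ] H) : Prop :=
  ∀ u f : H, (u, f) ∈ A ↔
    Tendsto (fun t : ℝ≥0 => (((t : ℝ) : ℂ))⁻¹ • (S t u - u)) (𝓝[>] 0) (𝓝 f)

end Semigroup

section Submarkovian

variable {X : Type*} [MeasurableSpace X] {μ : Measure X}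

/-- `f ≥ 0` for a complex-valued `f ∈ L²`: almost everywhere `f(x)` is a nonnegative real. -/
def IsNonneg (f : Lp ℂ 2 μ) : Prop := ∀ᵐ x ∂μ, 0 ≤ (f x).re ∧ (f x).im = 0

/-- Positivity of a family of operators on complex `L²`. -/
def IsPositive (S : ℝ≥0 → Lp ℂ 2 μ →L[ℂ] Lp ℂ 2 μ) : Prop :=
  ∀ t : ℝ≥0, 0 < t → ∀ f : Lp ℂ 2 μ, IsNonneg f → IsNonneg (S t f)

/-- `L^∞`-contractivity (on a finite measure space, where `L^∞ ⊆ L²`). -/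
def IsLinftyContractive (S : ℝ≥0 → Lp ℂ 2 μ →L[ℂ] Lp ℂ 2 μ) : Prop :=
  ∀ t : ℝ≥0, 0 < t → ∀ f : Lp ℂ 2 μ, MemLp f ∞ μ → eLpNorm (S t f) ∞ μ ≤ eLpNorm f ∞ μ

/-- Submarkovian: positive and `L^∞`-contractive. -/
def IsSubmarkovian (S : ℝ≥0 → Lp ℂ 2 μ →L[ℂ] Lp ℂ 2 μ) : Prop :=
  IsPositive S ∧ IsLinftyContractive S

/-- The operator with graph `A` generates a submarkovian `C₀`-semigroup on `L²`. -/
def GeneratesSubmarkovianC0Semigroup (A : Set (Lp ℂ 2 μ × Lp ℂ 2 μ)) : Prop :=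
  ∃ S : ℝ≥0 → Lp ℂ 2 μ →L[ℂ] Lp ℂ 2 μ,
    IsC0Semigroup S ∧ IsGenerator A S ∧ IsSubmarkovian S

end Submarkovian

/-! ### Sobolev space and Neumann Laplacian on an open set -/

section Neumann

variable {d : ℕ} (Ω : Opens (EuclideanSpace ℝ (Fin d)))

/-- Complex `L²(Ω)` with Lebesgue measure. -/
abbrev L2 : Type := Lp ℂ 2 ((volume : Measure (EuclideanSpace ℝ (Fin d))).restrict Ω)

variable {Ω}

/-- The `i`-th partial derivative of a test function. -/
def pd (i : Fin d) (φ : 𝓓(Ω, ℝ)) : 𝓓(Ω, ℝ) := ∂_{EuclideanSpace.single i (1 : ℝ)} φ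

theorem pd_apply (i : Fin d) (φ : 𝓓(Ω, ℝ)) (x : EuclideanSpace ℝ (Fin d)) :
    pd i φ x = fderiv ℝ φ x (EuclideanSpace.single i 1) := by
  have h : DifferentiableAt ℝ (φ : EuclideanSpace ℝ (Fin d) → ℝ) x :=
    (φ.contDiff.differentiable (by simp)).differentiableAt
  rw [← h.lineDeriv_eq_fderiv]
  exact TestFunction.lineDerivCLM_apply_of_le (𝕜 := ℝ) (n := ⊤) (k := ⊤) (by simp)

/-- `g = ∇u` in the weak sense: `∫_Ω u ∂ᵢφ = -∫_Ω gᵢ φ` for all `i` and all test functions `φ`. -/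
def IsWeakGradient (u : L2 Ω) (g : Fin d → L2 Ω) : Prop :=
  ∀ (i : Fin d) (φ : 𝓓(Ω, ℝ)),
    ∫ x in (Ω : Set (EuclideanSpace ℝ (Fin d))), (pd i φ x) • u x =
      - ∫ x in (Ω : Set (EuclideanSpace ℝ (Fin d))), (φ x) • g i x

/-- `f = Δu` in the sense of distributions: `∫_Ω u Δφ = ∫_Ω f φ` for all test functions `φ`. -/
def IsWeakLaplacian (u f : L2 Ω) : Prop :=
  ∀ φ : 𝓓(Ω, ℝ),
    ∫ x in (Ω : Set (EuclideanSpace ℝ (Fin d))), (∑ i : Fin d, pd i (pd i φ) x) • u x =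
      ∫ x in (Ω : Set (EuclideanSpace ℝ (Fin d))), (φ x) • f x

variable (Ω)

/-- `H¹(Ω)`, each element `u` being recorded together with its weak gradient as the pair `(u, ∇u)`.
The topology inherited from `L²(Ω) × L²(Ω)^d` is that of the `H¹`-norm. -/
def H1 : Set (L2 Ω × (Fin d → L2 Ω)) := {w | IsWeakGradient w.1 w.2}

/-- `C(Ω̄) ∩ H¹(Ω)`: the elements of `H¹(Ω)` having a representative that is continuous on the
closure of `Ω`. -/
def H1Cont : Set (L2 Ω × (Fin d → L2 Ω)) :=
  {w | w ∈ H1 Ω ∧ ∃ v : EuclideanSpace ℝ (Fin d) → ℂ,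
    ContinuousOn v (closure (Ω : Set (EuclideanSpace ℝ (Fin d)))) ∧
    ∀ᵐ x ∂(volume.restrict (Ω : Set (EuclideanSpace ℝ (Fin d)))), w.1 x = v x}

variable {Ω}

/-- `∂_ν u = 0` in the sense of Green's formula, where `g = ∇u`, `f = Δu`:
`∫_Ω (Δu) v̄ + ∫_Ω ∇u · conj ∇v = 0` for all `v` in the class `T ⊆ H¹(Ω)` of test functions
(the boundary integral `∫_Γ h v̄` vanishes for `h = 0`). -/
def NormalDerivEqZero (T : Set (L2 Ω × (Fin d → L2 Ω))) (g : Fin d → L2 Ω) (f : L2 Ω) : Prop :=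
  ∀ w ∈ T,
    (∫ x in (Ω : Set (EuclideanSpace ℝ (Fin d))), f x * conj (w.1 x)) +
      (∫ x in (Ω : Set (EuclideanSpace ℝ (Fin d))), ∑ i : Fin d, g i x * conj (w.2 i x)) = 0

/-- Graph of the realisation `u ↦ Δu` in `L²(Ω)` with domain
`{u ∈ H¹(Ω) : Δu ∈ L²(Ω), ∂_ν u = 0}`, the normal derivative being tested against `T`. -/
def neumannGraph (T : Set (L2 Ω × (Fin d → L2 Ω))) : Set (L2 Ω × L2 Ω) :=
  {p | ∃ g : Fin d → L2 Ω,
    IsWeakGradient p.1 g ∧ IsWeakLaplacian p.1 p.2 ∧ NormalDerivEqZero T g p.2}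

variable (Ω)

/-- The Neumann Laplacian (its graph): Green's formula is tested against all of `H¹(Ω)`. -/
def neumannLaplacian : Set (L2 Ω × L2 Ω) := neumannGraph (H1 Ω)

/-- The variant (its graph) in which Green's formula is tested only against `C(Ω̄) ∩ H¹(Ω)`. -/
def neumannLaplacianCont : Set (L2 Ω × L2 Ω) := neumannGraph (H1Cont Ω)

end Neumann

end NeumannLap

end

/-!
`H¹(Ω)` embeds contractively and densely in `L²(Ω)`; with `J` the inclusion, the weak Neumann
problem `u - Δu = v` is solved by `u = J J* v`. So `R = (1 - Δᴺ)⁻¹ = J J*` is self-adjoint and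
injective with `0 ≤ R ≤ 1`, and the continuous functional calculus applied to
`x ↦ exp (-t (x⁻¹ - 1))` produces the semigroup. By the exponential formula
`S(t) = lim (1 - (t/n) Δᴺ)⁻ⁿ`, a closed set invariant under all `(1 - h Δᴺ)⁻¹` is invariant
under `S(t)`. For the functions with values in a half-plane containing the origin this resolvent
invariance is Stampacchia's truncation argument: Green's formula is tested against `G(Re u)` with
`G` smooth and increasing. These half-planes together encode positivity and `L^∞`-contractivity.

Green's formula is continuous in the test function for the `H¹`-norm, so testing against a subset
that is dense in `H¹(Ω)` defines the same operator.
-/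

noncomputable section

namespace NeumannLap

section Symbols

open Real

theorem inv_one_add_le {a : ℝ} (ha : 0 ≤ a) : (1 + a)⁻¹ ≤ 1 - a + a ^ 2 := by
  rw [inv_le_iff_one_le_mul₀ (by positivity)]
  linarith [pow_nonneg ha 3]

theorem exp_neg_le_inv_one_add {a : ℝ} (ha : 0 ≤ a) : exp (-a) ≤ (1 + a)⁻¹ := by
  rw [exp_neg]
  exact inv_anti₀ (by positivity) (by linarith [add_one_le_exp a])

theorem abs_exp_neg_sub_le {a : ℝ} (ha : 0 ≤ a) : |exp (-a) - (1 - a)| ≤ a ^ 2 := by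
  rw [abs_of_nonneg (sub_nonneg.2 (one_sub_le_exp_neg a))]
  linarith [exp_neg_le_inv_one_add ha, inv_one_add_le ha]

theorem abs_inv_one_add_pow_sub_exp_le {b : ℝ} (hb : 0 ≤ b) (n : ℕ) :
    |(1 + b)⁻¹ ^ n - exp (-(n * b))| ≤ n * b ^ 2 := by
  have hdiff : |(1 + b)⁻¹ - exp (-b)| ≤ b ^ 2 := by
    rw [abs_of_nonneg (sub_nonneg.2 (exp_neg_le_inv_one_add hb))]
    linarith [inv_one_add_le hb, one_sub_le_exp_neg b]
  have hmax : max |(1 + b)⁻¹| |exp (-b)| ≤ 1 := by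
    rw [abs_of_nonneg (by positivity), abs_exp]
    exact max_le (inv_le_one_of_one_le₀ (by linarith)) (exp_le_one_iff.2 (neg_nonpos.2 hb))
  calc |(1 + b)⁻¹ ^ n - exp (-(n * b))| = |(1 + b)⁻¹ ^ n - exp (-b) ^ n| := by
        rw [← exp_nat_mul, mul_neg]
    _ ≤ |(1 + b)⁻¹ - exp (-b)| * n * max |(1 + b)⁻¹| |exp (-b)| ^ (n - 1) :=
        abs_pow_sub_pow_le _ _ n
    _ ≤ b ^ 2 * n * 1 := by
        gcongr
        exact pow_le_one₀ (le_max_of_le_left (abs_nonneg _)) hmax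
    _ = n * b ^ 2 := by ring

/-- The function `x ↦ exp (-t (x⁻¹ - 1))`, extended by `0 ^ t` to `x ≤ 0`: the symbol of the
semigroup `exp (t A)` in terms of the spectral variable `x` of `R = (1 - A)⁻¹`. -/
def heatSymbol (t x : ℝ) : ℝ := (exp 1 * expNegInvGlue x) ^ t

/-- The symbol of the resolvent `(1 - h A)⁻¹` in terms of the spectral variable `x` of
`R = (1 - A)⁻¹`. -/
def resolventSymbol (h x : ℝ) : ℝ := x / (x + h * (1 - x))

variable {s t h x : ℝ}

theorem continuous_heatSymbol (ht : 0 ≤ t) : Continuous (heatSymbol t) :=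
  (continuous_const.mul (expNegInvGlue.contDiff (n := 0)).continuous).rpow_const fun _ => .inr ht

theorem heatSymbol_zero_left (x : ℝ) : heatSymbol 0 x = 1 := rpow_zero _

theorem heatSymbol_add (hs : 0 ≤ s) (ht : 0 ≤ t) (x : ℝ) :
    heatSymbol (s + t) x = heatSymbol s x * heatSymbol t x :=
  rpow_add_of_nonneg (mul_nonneg (exp_pos 1).le (expNegInvGlue.nonneg x)) hs ht

theorem heatSymbol_of_pos (t : ℝ) (hx : 0 < x) : heatSymbol t x = exp (-(t * (x⁻¹ - 1))) := by
  rw [heatSymbol, expNegInvGlue, if_neg hx.not_ge, ← exp_add, ← exp_mul]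
  ring_nf

theorem inv_sub_one_nonneg (hx₀ : 0 < x) (hx₁ : x ≤ 1) : 0 ≤ x⁻¹ - 1 :=
  sub_nonneg.2 ((one_le_inv₀ hx₀).2 hx₁)

theorem heatSymbol_mem_Icc (ht : 0 ≤ t) (hx : x ∈ Set.Icc (0 : ℝ) 1) :
    heatSymbol t x ∈ Set.Icc (0 : ℝ) 1 := by
  have hbase : 0 ≤ exp 1 * expNegInvGlue x := mul_nonneg (exp_pos 1).le (expNegInvGlue.nonneg x)
  refine ⟨rpow_nonneg hbase t, ?_⟩
  rcases hx.1.eq_or_lt with rfl | hx₀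
  · rw [heatSymbol, expNegInvGlue.zero, mul_zero]
    exact zero_rpow_le_one t
  · rw [heatSymbol_of_pos t hx₀, exp_le_one_iff, neg_nonpos]
    exact mul_nonneg ht (inv_sub_one_nonneg hx₀ hx.2)

theorem abs_heatSymbol_sub_one_mul_le (ht : 0 ≤ t) (hx : x ∈ Set.Icc (0 : ℝ) 1) :
    |(heatSymbol t x - 1) * x| ≤ t := by
  rcases hx.1.eq_or_lt with rfl | hx₀
  · simpa using ht
  have hlower : -(t * (x⁻¹ - 1)) ≤ heatSymbol t x - 1 := by
    rw [heatSymbol_of_pos t hx₀]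
    linarith [one_sub_le_exp_neg (t * (x⁻¹ - 1))]
  rw [abs_mul, abs_of_nonpos (sub_nonpos.2 (heatSymbol_mem_Icc ht hx).2), abs_of_pos hx₀]
  calc -(heatSymbol t x - 1) * x ≤ t * (x⁻¹ - 1) * x := by gcongr; linarith
    _ = t * (1 - x) := by field_simp
    _ ≤ t := mul_le_of_le_one_right ht (by linarith)

theorem abs_heatSymbol_sub_linear_mul_sq_le (ht : 0 ≤ t) (hx : x ∈ Set.Icc (0 : ℝ) 1) :
    |(heatSymbol t x - 1) * x ^ 2 - t * (x - 1) * x| ≤ t ^ 2 := by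
  rcases hx.1.eq_or_lt with rfl | hx₀
  · simpa using sq_nonneg t
  have ha := mul_nonneg ht (inv_sub_one_nonneg hx₀ hx.2)
  have hfactor : (heatSymbol t x - 1) * x ^ 2 - t * (x - 1) * x =
      (exp (-(t * (x⁻¹ - 1))) - (1 - t * (x⁻¹ - 1))) * x ^ 2 := by
    rw [heatSymbol_of_pos t hx₀]
    field_simp
    ring
  rw [hfactor, abs_mul, abs_of_nonneg (sq_nonneg x)]
  calc _ ≤ (t * (x⁻¹ - 1)) ^ 2 * x ^ 2 := by gcongr; exact abs_exp_neg_sub_le ha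
    _ = t ^ 2 * (1 - x) ^ 2 := by field_simp
    _ ≤ t ^ 2 := mul_le_of_le_one_right (sq_nonneg t) (by nlinarith [hx.1, hx.2])

theorem abs_inv_mul_heatSymbol_sub_one_mul_le (ht : 0 ≤ t) (hx : x ∈ Set.Icc (0 : ℝ) 1) :
    |t⁻¹ * ((heatSymbol t x - 1) * x)| ≤ 1 := by
  rw [abs_mul, abs_of_nonneg (inv_nonneg.2 ht)]
  exact inv_mul_le_one_of_le₀ (abs_heatSymbol_sub_one_mul_le ht hx) ht

theorem abs_inv_mul_heatSymbol_sub_one_mul_sub_le (ht : 0 < t) (hx : x ∈ Set.Icc (0 : ℝ) 1) :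
    |(t⁻¹ * ((heatSymbol t x - 1) * x) - (x - 1)) * x ^ 2| ≤ t := by
  have hfactor : (t⁻¹ * ((heatSymbol t x - 1) * x) - (x - 1)) * x ^ 2 =
      t⁻¹ * ((heatSymbol t x - 1) * x ^ 2 - t * (x - 1) * x) * x := by field_simp
  rw [hfactor, abs_mul, abs_mul, abs_of_pos (inv_pos.2 ht), abs_of_nonneg hx.1]
  refine (mul_le_of_le_one_right (by positivity) hx.2).trans ?_
  rw [inv_mul_le_iff₀ ht, ← sq]
  exact abs_heatSymbol_sub_linear_mul_sq_le ht.le hx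

theorem resolventSymbol_denom_pos (hh : 0 < h) (hx : x ∈ Set.Icc (0 : ℝ) 1) :
    0 < x + h * (1 - x) := by
  rcases hx.1.eq_or_lt with rfl | hx₀
  · simpa
  · linarith [mul_nonneg hh.le (sub_nonneg.2 hx.2)]

theorem resolventSymbol_mem_Icc (hh : 0 < h) (hx : x ∈ Set.Icc (0 : ℝ) 1) :
    resolventSymbol h x ∈ Set.Icc (0 : ℝ) 1 := by
  have hpos := resolventSymbol_denom_pos hh hx
  refine ⟨div_nonneg hx.1 hpos.le, (div_le_one hpos).2 ?_⟩
  linarith [mul_nonneg hh.le (sub_nonneg.2 hx.2)]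

theorem resolventSymbol_of_pos (hh : 0 < h) (hx₀ : 0 < x) (hx₁ : x ≤ 1) :
    resolventSymbol h x = (1 + h * (x⁻¹ - 1))⁻¹ := by
  have hpos := resolventSymbol_denom_pos hh ⟨hx₀.le, hx₁⟩
  have hfrac : 1 + h * (x⁻¹ - 1) = (x + h * (1 - x)) / x := by field_simp
  rw [hfrac, inv_div, resolventSymbol]

theorem abs_resolventSymbol_pow_sub_heatSymbol_mul_sq_le (hh : 0 < h)
    (hx : x ∈ Set.Icc (0 : ℝ) 1) (n : ℕ) :
    |(resolventSymbol h x ^ n - heatSymbol (n * h) x) * x ^ 2| ≤ n * h ^ 2 := by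
  rcases hx.1.eq_or_lt with rfl | hx₀
  · simp only [zero_pow two_ne_zero, mul_zero, abs_zero]
    positivity
  have hb := mul_nonneg hh.le (inv_sub_one_nonneg hx₀ hx.2)
  rw [resolventSymbol_of_pos hh hx₀ hx.2, heatSymbol_of_pos _ hx₀, mul_assoc (n : ℝ), abs_mul,
    abs_of_nonneg (sq_nonneg x)]
  calc _ ≤ n * (h * (x⁻¹ - 1)) ^ 2 * x ^ 2 := by
        gcongr; exact abs_inv_one_add_pow_sub_exp_le hb n
    _ = n * h ^ 2 * (1 - x) ^ 2 := by field_simp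
    _ ≤ n * h ^ 2 := mul_le_of_le_one_right (by positivity) (by nlinarith [hx.1, hx.2])

end Symbols

theorem tendsto_apply_of_denseRange {𝕜 E F ι α : Type*} [NontriviallyNormedField 𝕜]
    [NormedAddCommGroup E] [NormedSpace 𝕜 E] [NormedAddCommGroup F] [NormedSpace 𝕜 F]
    {l : Filter ι} {T : ι → E →L[𝕜] F} {T₀ : E →L[𝕜] F} {C : ℝ≥0} (hT : ∀ i, ‖T i‖ ≤ C)
    {r : α → E} (hr : DenseRange r) (h : ∀ a, Tendsto (fun i => T i (r a)) l (𝓝 (T₀ (r a))))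
    (v : E) : Tendsto (fun i => T i v) l (𝓝 (T₀ v)) := by
  have hequi : EquicontinuousAt (fun i => ⇑(T i)) v :=
    (LipschitzWith.uniformEquicontinuous _ C
      fun i => (T i).lipschitz.weaken (hT i)).equicontinuous v
  exact hequi.tendsto_of_mem_closure (T₀.continuous.tendsto v |>.mono_left nhdsWithin_le_nhds)
    (Set.forall_mem_range.2 h) (hr v)

section Semigroup

variable {H : Type*} [NormedAddCommGroup H] [InnerProductSpace ℂ H] [CompleteSpace H]

theorem denseRange_of_isSelfAdjoint_of_injective {R : H →L[ℂ] H} (hR : IsSelfAdjoint R)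
    (hinj : Function.Injective R) : DenseRange R := by
  have hperp : R.rangeᗮ = ⊥ := by
    rw [ContinuousLinearMap.orthogonal_range, hR.adjoint_eq]
    exact LinearMap.ker_eq_bot.2 hinj
  exact Submodule.dense_iff_topologicalClosure_eq_top.2
    (Submodule.topologicalClosure_eq_top_iff.2 hperp)

/-- The weight `x ^ 2` means that convergence is only asked for on the range of `R ^ 2`, which is
dense. -/
theorem tendsto_cfc_apply {ι : Type*} {l : Filter ι} {R : H →L[ℂ] H} (hR : IsSelfAdjoint R)
    (hinj : Function.Injective R) {F : ι → ℝ → ℝ} {f : ℝ → ℝ} {C : ℝ≥0} {ε : ι → ℝ}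
    (hF : ∀ i, ContinuousOn (F i) (spectrum ℝ R)) (hf : ContinuousOn f (spectrum ℝ R))
    (hC : ∀ i, ∀ x ∈ spectrum ℝ R, |F i x| ≤ C) (hε : Tendsto ε l (𝓝 0))
    (h : ∀ᶠ i in l, 0 ≤ ε i ∧ ∀ x ∈ spectrum ℝ R, |(F i x - f x) * x ^ 2| ≤ ε i) (v : H) :
    Tendsto (fun i => cfc (F i) R v) l (𝓝 (cfc f R v)) := by
  have hd := denseRange_of_isSelfAdjoint_of_injective hR hinj
  refine tendsto_apply_of_denseRange (fun i => norm_cfc_le C.2 (hC i)) (hd.comp hd R.continuous)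
    (fun w => ?_) v
  have hprod : ∀ i, cfc (F i) R (R (R w)) - cfc f R (R (R w)) =
      cfc (fun x => (F i x - f x) * x ^ 2) R w := fun i => by
    rw [cfc_mul (fun x => F i x - f x) (fun x => x ^ 2) R, cfc_sub (F i) f R, cfc_pow_id R 2]
    rfl
  refine tendsto_iff_norm_sub_tendsto_zero.2
    (squeeze_zero' (.of_forall fun _ => norm_nonneg _) ?_ (by simpa using hε.mul_const ‖w‖))
  filter_upwards [h] with i hi
  rw [Function.comp_apply, hprod]
  exact ContinuousLinearMap.le_of_opNorm_le _ (norm_cfc_le hi.1 hi.2) w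

/-- `R = (1 - A)⁻¹` for the operator with graph `A`. -/
def IsResolventAtOne (R : H →L[ℂ] H) (A : Set (H × H)) : Prop :=
  ∀ u f : H, (u, f) ∈ A ↔ R (u - f) = u

/-- The semigroup with generator `1 - R⁻¹`, that is `exp (t A)` for `R = (1 - A)⁻¹`. -/
def cfcSemigroup (R : H →L[ℂ] H) (t : ℝ≥0) : H →L[ℂ] H := cfc (heatSymbol t) R

variable {R : H →L[ℂ] H} {A : Set (H × H)}

theorem spectrum_subset_Icc (hR : R ∈ Set.Icc 0 1) : spectrum ℝ R ⊆ Set.Icc 0 1 := by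
  intro x hx
  refine ⟨spectrum_nonneg_of_nonneg hR.1 hx, ?_⟩
  have hle := (le_algebraMap_iff_spectrum_le (R := ℝ) (r := 1) (a := R)
    (IsSelfAdjoint.of_nonneg hR.1)).1 (by simpa using hR.2)
  exact hle x hx

theorem abs_heatSymbol_le_one (hR : R ∈ Set.Icc 0 1) (t : ℝ≥0) :
    ∀ x ∈ spectrum ℝ R, |heatSymbol t x| ≤ 1 := fun _ hx =>
  have hmem := heatSymbol_mem_Icc t.coe_nonneg (spectrum_subset_Icc hR hx)
  (abs_of_nonneg hmem.1).trans_le hmem.2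

theorem tendsto_coe_nhdsGT_zero : Tendsto (fun t : ℝ≥0 => (t : ℝ)) (𝓝[>] 0) (𝓝 0) :=
  (NNReal.continuous_coe.tendsto' 0 0 rfl).mono_left nhdsWithin_le_nhds

theorem cfcSemigroup_zero (hR : IsSelfAdjoint R) : cfcSemigroup R 0 = 1 := by
  rw [cfcSemigroup, NNReal.coe_zero, cfc_congr fun x _ => heatSymbol_zero_left x,
    cfc_const_one ℝ R]

theorem cfcSemigroup_add (R : H →L[ℂ] H) (s t : ℝ≥0) :
    cfcSemigroup R (s + t) = cfcSemigroup R s * cfcSemigroup R t := by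
  have hcont (r : ℝ≥0) := (continuous_heatSymbol r.coe_nonneg).continuousOn (s := spectrum ℝ R)
  rw [cfcSemigroup, cfcSemigroup, cfcSemigroup, ← cfc_mul _ _ R (hcont s) (hcont t)]
  exact cfc_congr fun x _ => heatSymbol_add s.coe_nonneg t.coe_nonneg x

theorem tendsto_cfcSemigroup (hR : R ∈ Set.Icc 0 1) (hinj : Function.Injective R) (v : H) :
    Tendsto (fun t => cfcSemigroup R t v) (𝓝[>] 0) (𝓝 v) := by
  have hsa := IsSelfAdjoint.of_nonneg hR.1
  have hbound : ∀ t : ℝ≥0, ∀ x ∈ spectrum ℝ R, |(heatSymbol t x - 1) * x ^ 2| ≤ (t : ℝ) := by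
    intro t x hx
    have hx := spectrum_subset_Icc hR hx
    rw [sq, ← mul_assoc, abs_mul _ x, abs_of_nonneg hx.1]
    exact (mul_le_of_le_one_right (abs_nonneg _) hx.2).trans
      (abs_heatSymbol_sub_one_mul_le t.coe_nonneg hx)
  have hlim := tendsto_cfc_apply (C := 1) hsa hinj
    (fun t : ℝ≥0 => (continuous_heatSymbol t.coe_nonneg).continuousOn) continuousOn_const
    (abs_heatSymbol_le_one hR) tendsto_coe_nhdsGT_zero
    (.of_forall fun t => ⟨t.coe_nonneg, hbound t⟩) v
  rwa [cfc_const_one ℝ R] at hlim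

theorem isC0Semigroup_cfcSemigroup (hR : R ∈ Set.Icc 0 1) (hinj : Function.Injective R) :
    IsC0Semigroup (cfcSemigroup R) where
  zero := cfcSemigroup_zero (.of_nonneg hR.1)
  add := cfcSemigroup_add R
  strongly_continuous := tendsto_cfcSemigroup hR hinj

theorem tendsto_cfcSemigroup_slope (hR : R ∈ Set.Icc 0 1) (hinj : Function.Injective R) (v : H) :
    Tendsto (fun t : ℝ≥0 => ((t : ℝ) : ℂ)⁻¹ • (cfcSemigroup R t (R v) - R v)) (𝓝[>] 0)
      (𝓝 (R v - v)) := by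
  have hsa := IsSelfAdjoint.of_nonneg hR.1
  have hcont (t : ℝ≥0) := (continuous_heatSymbol t.coe_nonneg).continuousOn (s := spectrum ℝ R)
  have hmain := tendsto_cfc_apply (C := 1) hsa hinj
    (F := fun (t : ℝ≥0) x => (t : ℝ)⁻¹ * ((heatSymbol t x - 1) * x)) (f := fun x => x - 1)
    (fun t => by fun_prop) (by fun_prop)
    (fun t x hx => abs_inv_mul_heatSymbol_sub_one_mul_le t.coe_nonneg (spectrum_subset_Icc hR hx))
    tendsto_coe_nhdsGT_zero (by
      filter_upwards [self_mem_nhdsWithin] with t ht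
      exact ⟨t.coe_nonneg, fun x hx =>
        abs_inv_mul_heatSymbol_sub_one_mul_sub_le ht (spectrum_subset_Icc hR hx)⟩) v
  have hslope (t : ℝ≥0) : cfc (fun x => (t : ℝ)⁻¹ * ((heatSymbol t x - 1) * x)) R =
      (t : ℝ)⁻¹ • ((cfcSemigroup R t - 1) * R) := by
    rw [cfc_const_mul (t : ℝ)⁻¹ (fun x => (heatSymbol t x - 1) * x) R,
      cfc_mul (fun x => heatSymbol t x - 1) (fun x => x) R, cfc_sub (heatSymbol t) (fun _ => 1) R,
      cfc_const_one ℝ R, cfc_id' ℝ R, cfcSemigroup]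
  rw [cfc_sub (fun x => x) (fun _ => 1) R, cfc_const_one ℝ R, cfc_id' ℝ R] at hmain
  simp only [hslope] at hmain
  refine hmain.congr fun t => ?_
  rw [← Complex.ofReal_inv, ← Complex.coe_smul]
  rfl

theorem commute_cfcSemigroup (hR : IsSelfAdjoint R) (t : ℝ≥0) : Commute (cfcSemigroup R t) R := by
  simpa only [cfcSemigroup, cfc_id ℝ R] using cfc_commute_cfc (heatSymbol t) id R

theorem isGenerator_cfcSemigroup (hR : R ∈ Set.Icc 0 1) (hinj : Function.Injective R)
    (hA : IsResolventAtOne R A) : IsGenerator A (cfcSemigroup R) := by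
  intro u f
  rw [hA u f]
  constructor <;> intro h
  · have hslope := tendsto_cfcSemigroup_slope hR hinj (u - f)
    rwa [h, sub_sub_cancel] at hslope
  · have hslope := tendsto_cfcSemigroup_slope hR hinj u
    have hcomm (t : ℝ≥0) : cfcSemigroup R t (R u) = R (cfcSemigroup R t u) :=
      DFunLike.congr_fun (commute_cfcSemigroup (.of_nonneg hR.1) t).eq u
    have hRf : R f = R u - u :=
      tendsto_nhds_unique ((R.continuous.tendsto f).comp h) <| hslope.congr fun t => by
        rw [Function.comp_apply, map_smul, map_sub, hcomm]
    rw [map_sub, hRf, sub_sub_cancel]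

theorem continuousOn_resolventSymbol (hR : R ∈ Set.Icc 0 1) {h : ℝ} (hh : 0 < h) :
    ContinuousOn (resolventSymbol h) (spectrum ℝ R) :=
  ContinuousOn.div (by fun_prop) (by fun_prop) fun _ hx =>
    (resolventSymbol_denom_pos hh (spectrum_subset_Icc hR hx)).ne'

theorem cfc_resolventSymbol_mul (hR : R ∈ Set.Icc 0 1) {h : ℝ} (hh : 0 < h) :
    R * (h • cfc (resolventSymbol h) R - cfc (resolventSymbol h) R + 1) =
      h • cfc (resolventSymbol h) R := by
  have hsa := IsSelfAdjoint.of_nonneg hR.1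
  have hcont := continuousOn_resolventSymbol hR hh
  have hsymbol : ∀ x ∈ spectrum ℝ R,
      x * (h * resolventSymbol h x - resolventSymbol h x + 1) = h * resolventSymbol h x := by
    intro x hx
    have hne := (resolventSymbol_denom_pos hh (spectrum_subset_Icc hR hx)).ne'
    rw [resolventSymbol]
    field_simp
    ring
  have hcfc := cfc_congr (a := R) hsymbol
  rwa [cfc_mul (fun x => x) (fun x => h * resolventSymbol h x - resolventSymbol h x + 1) R,
    cfc_add R (fun x => h * resolventSymbol h x - resolventSymbol h x) (fun _ => 1),
    cfc_sub (fun x => h * resolventSymbol h x) (resolventSymbol h) R,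
    cfc_const_mul h (resolventSymbol h) R, cfc_const_one ℝ R, cfc_id' ℝ R] at hcfc

theorem exists_mem_eq_cfc_resolventSymbol (hR : R ∈ Set.Icc 0 1) (hA : IsResolventAtOne R A)
    {h : ℝ} (hh : 0 < h) (v : H) :
    ∃ f, (cfc (resolventSymbol h) R v, f) ∈ A ∧ cfc (resolventSymbol h) R v - h • f = v := by
  refine ⟨h⁻¹ • (cfc (resolventSymbol h) R v - v), (hA _ _).2 ?_, ?_⟩
  · have hmul : R (h • cfc (resolventSymbol h) R v - cfc (resolventSymbol h) R v + v) =
        h • cfc (resolventSymbol h) R v := DFunLike.congr_fun (cfc_resolventSymbol_mul hR hh) v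
    have hscale : cfc (resolventSymbol h) R v - h⁻¹ • (cfc (resolventSymbol h) R v - v) =
        h⁻¹ • (h • cfc (resolventSymbol h) R v - cfc (resolventSymbol h) R v + v) := by
      simp only [sub_add, smul_sub, inv_smul_smul₀ hh.ne']
    rw [hscale, R.map_smul_of_tower, hmul, inv_smul_smul₀ hh.ne']
  · rw [smul_inv_smul₀ hh.ne', sub_sub_cancel]

theorem tendsto_cfc_resolventSymbol_pow (hR : R ∈ Set.Icc 0 1) (hinj : Function.Injective R)
    {t : ℝ≥0} (ht : 0 < t) (v : H) :
    Tendsto (fun n : ℕ => (cfc (resolventSymbol (t / (n + 1))) R ^ (n + 1)) v) atTop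
      (𝓝 (cfcSemigroup R t v)) := by
  have hsa := IsSelfAdjoint.of_nonneg hR.1
  have hstep (n : ℕ) : (0 : ℝ) < t / (n + 1) := div_pos ht n.cast_add_one_pos
  have hcont (n : ℕ) := continuousOn_resolventSymbol hR (hstep n)
  have hbdd : ∀ n : ℕ, ∀ x ∈ spectrum ℝ R, |resolventSymbol (t / (n + 1)) x ^ (n + 1)| ≤ 1 := by
    intro n x hx
    have hmem := resolventSymbol_mem_Icc (hstep n) (spectrum_subset_Icc hR hx)
    rw [abs_of_nonneg (pow_nonneg hmem.1 _)]
    exact pow_le_one₀ hmem.1 hmem.2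
  have hlim : ∀ n : ℕ, ∀ x ∈ spectrum ℝ R,
      |(resolventSymbol (t / (n + 1)) x ^ (n + 1) - heatSymbol t x) * x ^ 2| ≤
        t ^ 2 * (1 / ((n : ℝ) + 1)) := by
    intro n x hx
    have hle := abs_resolventSymbol_pow_sub_heatSymbol_mul_sq_le (hstep n)
      (spectrum_subset_Icc hR hx) (n + 1)
    rw [Nat.cast_add_one, mul_div_cancel₀ _ n.cast_add_one_ne_zero] at hle
    refine hle.trans_eq ?_
    field_simp
  have hmain := tendsto_cfc_apply (C := 1) hsa hinj
    (F := fun (n : ℕ) x => resolventSymbol (t / (n + 1)) x ^ (n + 1))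
    (fun n => (hcont n).pow (n + 1))
    (continuous_heatSymbol t.coe_nonneg).continuousOn hbdd
    (by simpa using tendsto_one_div_add_atTop_nhds_zero_nat.const_mul ((t : ℝ) ^ 2))
    (.of_forall fun n => ⟨by positivity, hlim n⟩) v
  refine hmain.congr fun n => ?_
  rw [cfc_pow (resolventSymbol (t / (n + 1))) (n + 1) R]

theorem cfcSemigroup_mem_of_isClosed (hR : R ∈ Set.Icc 0 1) (hinj : Function.Injective R)
    (hA : IsResolventAtOne R A) {C : Set H} (hC : IsClosed C)
    (hinv : ∀ h : ℝ, 0 < h → ∀ u f : H, (u, f) ∈ A → u - h • f ∈ C → u ∈ C)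
    {t : ℝ≥0} (ht : 0 < t) {v : H} (hv : v ∈ C) : cfcSemigroup R t v ∈ C := by
  have hresolvent {h : ℝ} (hh : 0 < h) {w : H} (hw : w ∈ C) : cfc (resolventSymbol h) R w ∈ C := by
    obtain ⟨f, hf, hfw⟩ := exists_mem_eq_cfc_resolventSymbol hR hA hh w
    exact hinv h hh _ f hf (hfw.symm ▸ hw)
  have hpow {h : ℝ} (hh : 0 < h) (n : ℕ) : (cfc (resolventSymbol h) R ^ n) v ∈ C := by
    induction n with
    | zero => exact hv
    | succ n ih => rw [pow_succ']; exact hresolvent hh ih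
  exact hC.mem_of_tendsto (tendsto_cfc_resolventSymbol_pow hR hinj ht v)
    (.of_forall fun n => hpow (div_pos ht n.cast_add_one_pos) (n + 1))

end Semigroup

section WeakDerivative

theorem inner_toLp_toLp {α : Type*} [MeasurableSpace α] {μ : Measure α} {f g : α → ℝ}
    (hf : MemLp f 2 μ) (hg : MemLp g 2 μ) :
    inner ℝ (hf.toLp f) (hg.toLp g) = ∫ x, f x * g x ∂μ := by
  rw [L2.inner_def]
  refine integral_congr_ae ?_
  filter_upwards [hf.coeFn_toLp, hg.coeFn_toLp] with x hfx hgx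
  simp [hfx, hgx, mul_comm]

theorem abs_taylor_sub_le_of_lipschitzWith_deriv {G : ℝ → ℝ} {C : ℝ≥0} (hG : Differentiable ℝ G)
    (hG' : LipschitzWith C (deriv G)) (a b : ℝ) :
    |G b - G a - deriv G a * (b - a)| ≤ C * (b - a) ^ 2 := by
  have hderiv : ∀ x ∈ Set.uIcc a b,
      HasDerivWithinAt (fun x => G x - deriv G a * x) (deriv G x - deriv G a) (Set.uIcc a b) x :=
    fun x _ => by
      simpa using
        ((hG x).hasDerivAt.fun_sub ((hasDerivAt_id x).const_mul (deriv G a))).hasDerivWithinAt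
  have hbound : ∀ x ∈ Set.uIcc a b, ‖deriv G x - deriv G a‖ ≤ C * |b - a| := fun x hx =>
    (hG'.norm_sub_le x a).trans
      (mul_le_mul_of_nonneg_left (Set.abs_sub_left_of_mem_uIcc hx) C.coe_nonneg)
  have hmean := (convex_uIcc a b).norm_image_sub_le_of_norm_hasDerivWithin_le hderiv hbound
    Set.left_mem_uIcc Set.right_mem_uIcc
  calc |G b - G a - deriv G a * (b - a)| = |G b - deriv G a * b - (G a - deriv G a * a)| := by
        ring_nf
    _ ≤ C * |b - a| * |b - a| := hmean
    _ = C * (b - a) ^ 2 := by rw [mul_assoc, ← sq, sq_abs]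

theorem abs_integral_comp_sub_linearization_le {α : Type*} [MeasurableSpace α] {μ : Measure α}
    {G : ℝ → ℝ} {C : ℝ≥0} (hG : Differentiable ℝ G) (hG' : LipschitzWith C (deriv G))
    {u v φ : α → ℝ} (huv : MemLp (fun x => v x - u x) 2 μ) {M : ℝ} (hφ : ∀ x, ‖φ x‖ ≤ M) :
    |∫ x, ((G (v x) - G (u x)) * φ x - (v x - u x) * (deriv G (u x) * φ x)) ∂μ| ≤
      C * M * ‖huv.toLp _‖ ^ 2 := by
  rw [← real_inner_self_eq_norm_sq, inner_toLp_toLp, ← integral_const_mul, ← Real.norm_eq_abs]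
  have hint : Integrable (fun x => C * M * ((v x - u x) * (v x - u x))) μ :=
    (huv.integrable_mul huv).const_mul (C * M)
  refine norm_integral_le_of_norm_le hint (.of_forall fun x => ?_)
  calc ‖(G (v x) - G (u x)) * φ x - (v x - u x) * (deriv G (u x) * φ x)‖
      = |G (v x) - G (u x) - deriv G (u x) * (v x - u x)| * ‖φ x‖ := by
        rw [← Real.norm_eq_abs, ← norm_mul]
        ring_nf
    _ ≤ C * (v x - u x) ^ 2 * M := mul_le_mul (abs_taylor_sub_le_of_lipschitzWith_deriv hG hG' _ _)
        (hφ x) (norm_nonneg _) (by positivity)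
    _ = C * M * ((v x - u x) * (v x - u x)) := by ring

theorem memLp_comp_sub_comp {α : Type*} [MeasurableSpace α] {μ : Measure α} {G : ℝ → ℝ} {B : ℝ≥0}
    (hG : LipschitzWith B G) {u v : α → ℝ} (hu : AEStronglyMeasurable u μ)
    (hv : AEStronglyMeasurable v μ) {p : ℝ≥0∞} (huv : MemLp (fun x => v x - u x) p μ) :
    MemLp (fun x => G (v x) - G (u x)) p μ :=
  huv.of_le_mul ((hG.continuous.comp_aestronglyMeasurable hv).sub
    (hG.continuous.comp_aestronglyMeasurable hu)) (.of_forall fun x => hG.norm_sub_le (v x) (u x))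

theorem memLp_deriv_comp_mul {α : Type*} [MeasurableSpace α] {μ : Measure α} {G : ℝ → ℝ} {B : ℝ≥0}
    (hG : LipschitzWith B G) (hG' : Continuous (deriv G)) {u f : α → ℝ}
    (hu : AEStronglyMeasurable u μ) {p : ℝ≥0∞} (hf : MemLp f p μ) :
    MemLp (fun x => deriv G (u x) * f x) p μ :=
  hf.of_le_mul ((hG'.comp_aestronglyMeasurable hu).mul hf.aestronglyMeasurable)
    (.of_forall fun x => by
      rw [norm_mul]
      gcongr
      exact norm_deriv_le_of_lipschitz hG)

theorem locallyIntegrable_comp_of_lipschitzWith {X : Type*} [TopologicalSpace X]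
    [MeasurableSpace X] {μ : Measure X} [IsLocallyFiniteMeasure μ] {G : ℝ → ℝ} {B : ℝ≥0}
    (hG : LipschitzWith B G) {u : X → ℝ} {p : ℝ≥0∞} (hp : 1 ≤ p) (hu : MemLp u p μ) :
    LocallyIntegrable (fun x => G (u x)) μ := by
  have hdiff : MemLp (fun x => G (u x) - G 0) p μ :=
    memLp_comp_sub_comp hG aestronglyMeasurable_zero hu.aestronglyMeasurable (by simpa using hu)
  simpa [Pi.add_def] using (hdiff.locallyIntegrable hp).add (locallyIntegrable_const (G 0))

theorem memLp_comp_add_right {A : Type*} [AddGroup A] [MeasurableSpace A] [MeasurableAdd A]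
    {μ : Measure A} [μ.IsAddRightInvariant] {f : A → ℝ} {p : ℝ≥0∞}
    (hf : MemLp f p μ) (v : A) : MemLp (fun x => f (x + v)) p μ :=
  hf.comp_measurePreserving (measurePreserving_add_right μ v)

theorem integral_mul_comp_sub {A : Type*} [AddGroup A] [MeasurableSpace A] [MeasurableAdd A]
    {μ : Measure A} [μ.IsAddRightInvariant] (f φ : A → ℝ) (v : A) :
    ∫ x, f x * φ (x - v) ∂μ = ∫ x, f (x + v) * φ x ∂μ := by
  simpa only [add_sub_cancel_right] using
    (integral_add_right_eq_self (fun x => f x * φ (x - v)) v).symm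

theorem integral_comp_add_sub_mul {A : Type*} [NormedAddCommGroup A] [MeasurableSpace A]
    [BorelSpace A] {μ : Measure A} [μ.IsAddRightInvariant] [IsFiniteMeasureOnCompacts μ]
    {f φ : A → ℝ} (hf : LocallyIntegrable f μ) (hφ : Continuous φ) (hφc : HasCompactSupport φ)
    (v : A) :
    ∫ x, (f (x + v) - f x) * φ x ∂μ = (∫ x, f x * φ (x - v) ∂μ) - ∫ x, f x * φ x ∂μ := by
  have hint : Integrable (fun x => f x * φ x) μ :=
    hf.integrable_smul_right_of_hasCompactSupport hφ hφc
  have hint_sub : Integrable (fun x => f x * φ (x - v)) μ :=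
    hf.integrable_smul_right_of_hasCompactSupport (g := fun x => φ (x - v)) (by fun_prop)
      (hφc.comp_homeomorph (Homeomorph.subRight v))
  have hint_add : Integrable (fun x => f (x + v) * φ x) μ := by
    simpa only [add_sub_cancel_right] using hint_sub.comp_add_right v
  simp only [integral_mul_comp_sub, sub_mul, integral_sub hint_add hint]

theorem setIntegral_smul_eq_of_tsupport_subset {X F : Type*} [TopologicalSpace X]
    [MeasurableSpace X] {μ : Measure X} [NormedAddCommGroup F] [NormedSpace ℝ F] {U : Set X}
    {φ : X → ℝ} (hφ : tsupport φ ⊆ U) (u : X → F) :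
    ∫ x in U, φ x • u x ∂μ = ∫ x, φ x • u x ∂μ :=
  setIntegral_eq_integral_of_forall_compl_eq_zero fun x hx => by
    rw [image_eq_zero_of_notMem_tsupport fun hx' => hx (hφ hx'), zero_smul]

theorem setIntegral_mul_eq_of_eqOn_tsupport {X : Type*} [TopologicalSpace X] [MeasurableSpace X]
    {μ : Measure X} {U : Set X} {f f' φ : X → ℝ} (hφ : tsupport φ ⊆ U)
    (h : Set.EqOn f f' (tsupport φ)) : ∫ x in U, f x * φ x ∂μ = ∫ x, f' x * φ x ∂μ := by
  simp only [mul_comm _ (φ _), ← smul_eq_mul]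
  rw [setIntegral_smul_eq_of_tsupport_subset hφ]
  congr with x
  by_cases hx : x ∈ tsupport φ
  · rw [h hx]
  · rw [image_eq_zero_of_notMem_tsupport hx, zero_smul, zero_smul]

variable {E : Type*} [NormedAddCommGroup E] [NormedSpace ℝ E]

theorem tsupport_fderiv_apply_subset (φ : E → ℝ) (e : E) :
    tsupport (fun x => fderiv ℝ φ x e) ⊆ tsupport φ :=
  closure_minimal (fun _ hx => support_fderiv_subset ℝ fun h => hx (by simp [h]))
    (isClosed_tsupport φ)

theorem hasCompactSupport_fderiv_apply {φ : E → ℝ} (hφ : HasCompactSupport φ) (e : E) :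
    HasCompactSupport fun x => fderiv ℝ φ x e :=
  hφ.of_isClosed_subset (isClosed_tsupport _) (tsupport_fderiv_apply_subset φ e)

theorem continuous_fderiv_apply {φ : E → ℝ} (hφ : ContDiff ℝ 1 φ) (e : E) :
    Continuous fun x => fderiv ℝ φ x e :=
  (hφ.continuous_fderiv one_ne_zero).clm_apply continuous_const

theorem exists_contDiff_eq_one_nhdsSet [FiniteDimensional ℝ E] {K U : Set E} (hK : IsCompact K)
    (hU : IsOpen U) (hKU : K ⊆ U) :
    ∃ χ : E → ℝ, ContDiff ℝ (⊤ : ℕ∞) χ ∧ HasCompactSupport χ ∧ tsupport χ ⊆ U ∧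
      ∀ᶠ x in 𝓝ˢ K, χ x = 1 := by
  obtain ⟨L, hL, hKL, hLU⟩ := exists_compact_between hK hU hKU
  obtain ⟨χ, hχ1, hχ0, -⟩ := exists_contMDiffMap_one_nhds_of_subset_interior
    (modelWithCornersSelf ℝ E) (n := (⊤ : ℕ∞)) hK.isClosed hKL
  have hχL : tsupport χ ⊆ L :=
    closure_minimal (fun x hx => by_contra fun hxL => hx (hχ0 x hxL)) hL.isClosed
  exact ⟨χ, χ.contMDiff.contDiff, hL.of_isClosed_subset (isClosed_tsupport _) hχL,
    hχL.trans hLU, hχ1⟩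

variable [MeasurableSpace E] {μ : Measure E} {e : E}

/-- `g` is the weak derivative of `p` in the direction `e` on the set `U`. -/
def HasWeakDirDeriv (μ : Measure E) (U : Set E) (e : E) (p g : E → ℝ) : Prop :=
  ∀ φ : E → ℝ, ContDiff ℝ (⊤ : ℕ∞) φ → HasCompactSupport φ → tsupport φ ⊆ U →
    ∫ x in U, p x * fderiv ℝ φ x e ∂μ = -∫ x in U, g x * φ x ∂μ

variable [BorelSpace E]

/-- The increment of an `L²` function under translation by `s • e`, as an element of `L²`. -/
def translateIncrement [μ.IsAddRightInvariant] {w : E → ℝ} (hw : MemLp w 2 μ) (e : E) (s : ℝ) :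
    Lp ℝ 2 μ :=
  ((memLp_comp_add_right hw (s • e)).sub hw).toLp _

theorem inner_translateIncrement_toLp [μ.IsAddRightInvariant] {w ψ : E → ℝ} (hw : MemLp w 2 μ)
    (hψ : MemLp ψ 2 μ) (s : ℝ) :
    inner ℝ (translateIncrement hw e s) (hψ.toLp ψ) = ∫ x, (w (x + s • e) - w x) * ψ x ∂μ :=
  inner_toLp_toLp _ hψ

theorem HasWeakDirDeriv.cutoff [IsFiniteMeasureOnCompacts μ] {U : Set E} (hU : IsOpen U)
    {p g χ : E → ℝ} (hp : MemLp p 2 (μ.restrict U)) (hg : MemLp g 2 (μ.restrict U))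
    (hpg : HasWeakDirDeriv μ U e p g) (hχ : ContDiff ℝ (⊤ : ℕ∞) χ) (hχc : HasCompactSupport χ)
    (hχU : tsupport χ ⊆ U) :
    HasWeakDirDeriv μ Set.univ e (U.indicator fun x => χ x * p x)
      (U.indicator fun x => χ x * g x + fderiv ℝ χ x e * p x) := by
  intro φ hφ hφc _
  have hint : ∀ {q k : E → ℝ}, MemLp q 2 (μ.restrict U) → Continuous k → HasCompactSupport k →
      Integrable (fun x => q x * k x) (μ.restrict U) := fun hq hk hkc =>
    hq.integrable_mul ((hk.memLp_of_hasCompactSupport (p := 2) hkc).restrict U)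
  have hχ' := continuous_fderiv_apply (hχ.of_le (by exact_mod_cast le_top)) e
  have hφ' := continuous_fderiv_apply (hφ.of_le (by exact_mod_cast le_top)) e
  have hprod : ∀ x, fderiv ℝ (fun x => χ x * φ x) x e =
      χ x * fderiv ℝ φ x e + fderiv ℝ χ x e * φ x := fun x => by
    rw [fderiv_fun_mul (hχ.differentiable (by simp) x) (hφ.differentiable (by simp) x)]
    simp [mul_comm]
  have hweak := hpg (fun x => χ x * φ x) (hχ.mul hφ) hχc.mul_right
    (tsupport_mul_subset_left.trans hχU)
  simp only [hprod, mul_add] at hweak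
  have hpχφ' : Integrable (fun x => p x * (χ x * fderiv ℝ φ x e)) (μ.restrict U) :=
    hint hp (hχ.continuous.mul hφ') hχc.mul_right
  have hpχ'φ : Integrable (fun x => p x * (fderiv ℝ χ x e * φ x)) (μ.restrict U) :=
    hint hp (hχ'.mul hφ.continuous) hφc.mul_left
  have hgχφ : Integrable (fun x => g x * (χ x * φ x)) (μ.restrict U) :=
    hint hg (hχ.continuous.mul hφ.continuous) hφc.mul_left
  rw [integral_add hpχφ' hpχ'φ] at hweak
  have hind : ∀ q k : E → ℝ,
      ∫ x in Set.univ, U.indicator q x * k x ∂μ = ∫ x in U, q x * k x ∂μ := fun q k => by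
    simp only [Measure.restrict_univ, ← integral_indicator hU.measurableSet,
      Set.indicator_mul_left]
  rw [hind _ fun x => fderiv ℝ φ x e, hind _ φ]
  calc ∫ x in U, χ x * p x * fderiv ℝ φ x e ∂μ
      = ∫ x in U, p x * (χ x * fderiv ℝ φ x e) ∂μ := by congr with x; ring
    _ = -((∫ x in U, g x * (χ x * φ x) ∂μ) + ∫ x in U, p x * (fderiv ℝ χ x e * φ x) ∂μ) := by
        linarith
    _ = -∫ x in U, (χ x * g x + fderiv ℝ χ x e * p x) * φ x ∂μ := by
        rw [← integral_add hgχφ hpχ'φ]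
        congr with x
        ring

variable [FiniteDimensional ℝ E]

theorem denseRange_toLp_contDiff [IsFiniteMeasureOnCompacts μ] :
    DenseRange fun φ : {φ : E → ℝ // ContDiff ℝ (⊤ : ℕ∞) φ ∧ HasCompactSupport φ} =>
      (φ.2.1.continuous.memLp_of_hasCompactSupport φ.2.2 : MemLp φ.1 2 μ).toLp φ.1 := by
  refine (Lp.dense_hasCompactSupport_contDiff (by norm_num)).mono ?_
  rintro f ⟨φ, hfφ, hφc, hφ⟩
  exact ⟨⟨φ, hφ, hφc⟩, Lp.ext ((MemLp.coeFn_toLp _).trans hfφ.symm)⟩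

theorem hasDerivAt_integral_mul_comp_sub_smul [μ.IsAddLeftInvariant] [IsFiniteMeasureOnCompacts μ]
    {f φ : E → ℝ} (hf : LocallyIntegrable f μ) (hφ : ContDiff ℝ 1 φ) (hφc : HasCompactSupport φ)
    (e : E) (s : ℝ) :
    HasDerivAt (fun s : ℝ => ∫ x, f x * φ (x - s • e) ∂μ)
      (-∫ x, f x * fderiv ℝ φ (x - s • e) e ∂μ) s := by
  set ψ : E → ℝ := fun y => φ (-y) with hψdef
  have hψ : ContDiff ℝ 1 ψ := hφ.comp contDiff_neg
  have hψc : HasCompactSupport ψ := hφc.comp_homeomorph (Homeomorph.neg E)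
  have hfderiv : ∀ y, fderiv ℝ ψ y e = -fderiv ℝ φ (-y) e := fun y => by
    have hcomp : HasFDerivAt ψ _ y :=
      (hφ.differentiable one_ne_zero (-y)).hasFDerivAt.comp y (hasFDerivAt_id y).neg
    simp [hcomp.fderiv]
  have hline : HasDerivAt (fun s : ℝ => s • e) e s := by
    simpa using (hasDerivAt_id s).smul_const e
  have hconv := (hψc.hasFDerivAt_convolution_right (ContinuousLinearMap.mul ℝ ℝ) hf hψ
    (s • e)).comp_hasDerivAt s hline
  rw [convolution_precompR_apply _ hf (hψc.fderiv ℝ) (hψ.continuous_fderiv one_ne_zero)] at hconv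
  simp only [hfderiv] at hconv
  simpa [Function.comp_def, convolution_def, integral_neg, hψdef] using hconv

section WholeSpace

variable [μ.IsAddHaarMeasure] {w h : E → ℝ}

protected theorem HasWeakDirDeriv.hasDerivAt_integral_mul_comp_sub_smul (hw : MemLp w 2 μ)
    (hwh : HasWeakDirDeriv μ Set.univ e w h) {φ : E → ℝ} (hφ : ContDiff ℝ (⊤ : ℕ∞) φ)
    (hφc : HasCompactSupport φ) (s : ℝ) :
    HasDerivAt (fun s : ℝ => ∫ x, w x * φ (x - s • e) ∂μ) (∫ x, h x * φ (x - s • e) ∂μ) s := by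
  have hweak := hwh (fun x => φ (x - s • e)) (hφ.comp (contDiff_id.sub contDiff_const))
    (hφc.comp_homeomorph (Homeomorph.subRight (s • e))) (Set.subset_univ _)
  simp only [Measure.restrict_univ, fderiv_comp_sub] at hweak
  simpa only [hweak, neg_neg] using
    hasDerivAt_integral_mul_comp_sub_smul (hw.locallyIntegrable one_le_two)
      (hφ.of_le (by exact_mod_cast le_top)) hφc e s

theorem HasWeakDirDeriv.abs_inner_translateIncrement_le (hw : MemLp w 2 μ) (hh : MemLp h 2 μ)
    (hwh : HasWeakDirDeriv μ Set.univ e w h) {φ : E → ℝ} (hφ : ContDiff ℝ (⊤ : ℕ∞) φ)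
    (hφc : HasCompactSupport φ) (hφm : MemLp φ 2 μ) (s : ℝ) :
    |inner ℝ (translateIncrement hw e s) (hφm.toLp φ)| ≤ |s| * ‖hh.toLp h‖ * ‖hφm.toLp φ‖ := by
  have hbound : ∀ r ∈ (Set.univ : Set ℝ),
      ‖∫ x, h x * φ (x - r • e) ∂μ‖ ≤ ‖hh.toLp h‖ * ‖hφm.toLp φ‖ := by
    intro r _
    have hpres := measurePreserving_sub_right μ (r • e)
    calc ‖∫ x, h x * φ (x - r • e) ∂μ‖
        = |inner ℝ (hh.toLp h) ((hφm.comp_measurePreserving hpres).toLp _)| := by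
          rw [inner_toLp_toLp]; rfl
      _ ≤ ‖hh.toLp h‖ * ‖(hφm.comp_measurePreserving hpres).toLp _‖ := abs_real_inner_le_norm _ _
      _ = ‖hh.toLp h‖ * ‖hφm.toLp φ‖ := by
          rw [Lp.norm_toLp _ (hφm.comp_measurePreserving hpres), Lp.norm_toLp φ,
            eLpNorm_comp_measurePreserving hφm.aestronglyMeasurable hpres]
  have hmean := convex_univ.norm_image_sub_le_of_norm_hasDerivWithin_le
    (fun r _ => (hwh.hasDerivAt_integral_mul_comp_sub_smul hw hφ hφc r).hasDerivWithinAt)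
    hbound (Set.mem_univ 0) (Set.mem_univ s)
  simp only [zero_smul, sub_zero, Real.norm_eq_abs] at hmean
  rw [inner_translateIncrement_toLp, integral_comp_add_sub_mul (hw.locallyIntegrable one_le_two)
    hφ.continuous hφc]
  linarith

theorem HasWeakDirDeriv.norm_translateIncrement_le (hw : MemLp w 2 μ) (hh : MemLp h 2 μ)
    (hwh : HasWeakDirDeriv μ Set.univ e w h) (s : ℝ) :
    ‖translateIncrement hw e s‖ ≤ |s| * ‖hh.toLp h‖ := by
  rw [← innerSL_apply_norm (𝕜 := ℝ)]
  refine ContinuousLinearMap.opNorm_le_bound _ (by positivity) fun Ψ => ?_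
  exact denseRange_toLp_contDiff.induction_on Ψ (isClosed_le (by fun_prop) (by fun_prop))
    fun φ => hwh.abs_inner_translateIncrement_le hw hh φ.2.1 φ.2.2 _ s

theorem HasWeakDirDeriv.tendsto_integral_slope (hw : MemLp w 2 μ) (hh : MemLp h 2 μ)
    (hwh : HasWeakDirDeriv μ Set.univ e w h) {ψ : E → ℝ} (hψ : MemLp ψ 2 μ) :
    Tendsto (fun s : ℝ => s⁻¹ * ∫ x, (w (x + s • e) - w x) * ψ x ∂μ) (𝓝[≠] 0)
      (𝓝 (∫ x, h x * ψ x ∂μ)) := by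
  have hbound : ∀ s : ℝ, ‖innerSL ℝ (s⁻¹ • translateIncrement hw e s)‖ ≤ ‖hh.toLp h‖₊ := by
    intro s
    rcases eq_or_ne s 0 with rfl | hs
    · simp
    rw [innerSL_apply_norm, norm_smul, norm_inv, Real.norm_eq_abs, inv_mul_le_iff₀ (abs_pos.2 hs)]
    exact hwh.norm_translateIncrement_le hw hh s
  have hsmooth : ∀ φ : {φ : E → ℝ // ContDiff ℝ (⊤ : ℕ∞) φ ∧ HasCompactSupport φ},
      Tendsto (fun s : ℝ => s⁻¹ * ∫ x, (w (x + s • e) - w x) * φ.1 x ∂μ) (𝓝[≠] 0)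
        (𝓝 (∫ x, h x * φ.1 x ∂μ)) := by
    rintro ⟨φ, hφ, hφc⟩
    simpa only [zero_smul, sub_zero, zero_add, smul_eq_mul, integral_comp_add_sub_mul
      (hw.locallyIntegrable one_le_two) hφ.continuous hφc] using
      (hwh.hasDerivAt_integral_mul_comp_sub_smul hw hφ hφc 0).tendsto_slope_zero
  simpa only [innerSL_apply_apply, inner_toLp_toLp, real_inner_smul_left,
    inner_translateIncrement_toLp] using tendsto_apply_of_denseRange (T₀ := innerSL ℝ (hh.toLp h))
      hbound denseRange_toLp_contDiff (fun φ => by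
        simpa only [innerSL_apply_apply, inner_toLp_toLp, real_inner_smul_left,
          inner_translateIncrement_toLp] using hsmooth φ) (hψ.toLp ψ)

/-- The increments of `w` are `O(s)` in `L²`, so the Taylor error of `G` integrates to `O(s²)`. -/
theorem HasWeakDirDeriv.norm_slope_comp_sub_slope_mul_deriv_le (hw : MemLp w 2 μ)
    (hh : MemLp h 2 μ) (hwh : HasWeakDirDeriv μ Set.univ e w h) {G : ℝ → ℝ} {B C : ℝ≥0}
    (hG : Differentiable ℝ G) (hGB : LipschitzWith B G) (hGC : LipschitzWith C (deriv G))
    {φ : E → ℝ} (hφ : MemLp φ 2 μ) {M : ℝ} (hM : ∀ x, ‖φ x‖ ≤ M) (s : ℝ) :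
    ‖s⁻¹ * (∫ x, (G (w (x + s • e)) - G (w x)) * φ x ∂μ) -
      s⁻¹ * ∫ x, (w (x + s • e) - w x) * (deriv G (w x) * φ x) ∂μ‖ ≤
      |s| * (C * M * ‖hh.toLp h‖ ^ 2) := by
  have hsub : MemLp (fun x => w (x + s • e) - w x) 2 μ :=
    (memLp_comp_add_right hw (s • e)).sub hw
  have hGsub : MemLp (fun x => G (w (x + s • e)) - G (w x)) 2 μ :=
    memLp_comp_sub_comp hGB hw.aestronglyMeasurable
      (memLp_comp_add_right hw (s • e)).aestronglyMeasurable hsub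
  have hint : Integrable (fun x => (G (w (x + s • e)) - G (w x)) * φ x) μ :=
    hGsub.integrable_mul hφ
  have hint' : Integrable (fun x => (w (x + s • e) - w x) * (deriv G (w x) * φ x)) μ :=
    hsub.integrable_mul
      (memLp_deriv_comp_mul hGB hGC.continuous hw.aestronglyMeasurable hφ)
  rw [← mul_sub, ← integral_sub hint hint', norm_mul, norm_inv, Real.norm_eq_abs]
  have hM0 : 0 ≤ M := (norm_nonneg _).trans (hM 0)
  calc |s|⁻¹ * _ ≤ |s|⁻¹ * (C * M * (|s| * ‖hh.toLp h‖) ^ 2) := by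
        gcongr
        refine (abs_integral_comp_sub_linearization_le hG hGC hsub hM).trans ?_
        gcongr
        exact hwh.norm_translateIncrement_le hw hh s
    _ = |s| * (C * M * ‖hh.toLp h‖ ^ 2) := by
        rcases eq_or_ne s 0 with rfl | hs
        · simp
        · field_simp

theorem HasWeakDirDeriv.comp_univ (hw : MemLp w 2 μ) (hh : MemLp h 2 μ)
    (hwh : HasWeakDirDeriv μ Set.univ e w h) {G : ℝ → ℝ} {B C : ℝ≥0} (hG : Differentiable ℝ G)
    (hGB : LipschitzWith B G) (hGC : LipschitzWith C (deriv G)) :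
    HasWeakDirDeriv μ Set.univ e (fun x => G (w x)) (fun x => deriv G (w x) * h x) := by
  intro φ hφ hφc _
  simp only [Measure.restrict_univ, mul_comm _ (h _), mul_assoc]
  obtain ⟨M, hM⟩ := hφ.continuous.bounded_above_of_compact_support hφc
  have hφm : MemLp φ 2 μ := hφ.continuous.memLp_of_hasCompactSupport hφc
  have hGw : LocallyIntegrable (fun x => G (w x)) μ :=
    locallyIntegrable_comp_of_lipschitzWith hGB one_le_two hw
  have hψ : MemLp (fun x => deriv G (w x) * φ x) 2 μ :=
    memLp_deriv_comp_mul hGB hGC.continuous hw.aestronglyMeasurable hφm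
  have hslope := (hasDerivAt_integral_mul_comp_sub_smul hGw
    (hφ.of_le (by exact_mod_cast le_top)) hφc e 0).tendsto_slope_zero
  simp only [zero_smul, sub_zero, zero_add, smul_eq_mul,
    ← integral_comp_add_sub_mul hGw hφ.continuous hφc] at hslope
  have hzero : Tendsto (fun s : ℝ => |s| * (C * M * ‖hh.toLp h‖ ^ 2)) (𝓝[≠] 0) (𝓝 0) := by
    have hcont : Continuous fun s : ℝ => |s| * (C * M * ‖hh.toLp h‖ ^ 2) := by fun_prop
    simpa using (hcont.tendsto 0).mono_left nhdsWithin_le_nhds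
  have hlim := tendsto_nhds_unique (hslope.sub (hwh.tendsto_integral_slope hw hh hψ))
    (squeeze_zero_norm
      (hwh.norm_slope_comp_sub_slope_mul_deriv_le hw hh hG hGB hGC hφm hM) hzero)
  linarith

end WholeSpace

theorem HasWeakDirDeriv.comp [μ.IsAddHaarMeasure] {U : Set E} (hU : IsOpen U) {p g : E → ℝ}
    (hp : MemLp p 2 (μ.restrict U)) (hg : MemLp g 2 (μ.restrict U))
    (hpg : HasWeakDirDeriv μ U e p g) {G : ℝ → ℝ} {B C : ℝ≥0} (hG : Differentiable ℝ G)
    (hGB : LipschitzWith B G) (hGC : LipschitzWith C (deriv G)) :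
    HasWeakDirDeriv μ U e (fun x => G (p x)) (fun x => deriv G (p x) * g x) := by
  intro φ hφ hφc hφU
  obtain ⟨χ, hχ, hχc, hχU, hχ1⟩ := exists_contDiff_eq_one_nhdsSet hφc hU hφU
  have hχφ : ∀ x ∈ tsupport φ, χ x = 1 ∧ fderiv ℝ χ x e = 0 := fun x hx => by
    have hone : χ =ᶠ[𝓝 x] fun _ => 1 := eventually_nhdsSet_iff_forall.1 hχ1 x hx
    exact ⟨hone.eq_of_nhds, by simp [hone.fderiv_eq]⟩
  have hmul : ∀ {k q : E → ℝ}, Continuous k → HasCompactSupport k → MemLp q 2 (μ.restrict U) →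
      MemLp (fun x => k x * q x) 2 (μ.restrict U) := fun hk hkc hq =>
    hq.mul (hk.memLp_top_of_hasCompactSupport hkc _)
  have hw : MemLp (U.indicator fun x => χ x * p x) 2 μ :=
    (memLp_indicator_iff_restrict hU.measurableSet).2 (hmul hχ.continuous hχc hp)
  have hh : MemLp (U.indicator fun x => χ x * g x + fderiv ℝ χ x e * p x) 2 μ :=
    (memLp_indicator_iff_restrict hU.measurableSet).2 ((hmul hχ.continuous hχc hg).add
      (hmul (continuous_fderiv_apply (hχ.of_le (by exact_mod_cast le_top)) e)
        (hasCompactSupport_fderiv_apply hχc e) hp))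
  have hcomp := (hpg.cutoff hU hp hg hχ hχc hχU).comp_univ hw hh hG hGB hGC φ hφ hφc
    (Set.subset_univ _)
  rw [Measure.restrict_univ] at hcomp
  rw [setIntegral_mul_eq_of_eqOn_tsupport ((tsupport_fderiv_apply_subset φ e).trans hφU)
    fun x hx => ?_, hcomp, setIntegral_mul_eq_of_eqOn_tsupport hφU fun x hx => ?_]
  · simp [hφU hx, hχφ x hx]
  · have hx' := tsupport_fderiv_apply_subset φ e hx
    simp [hφU hx', hχφ x hx']

end WeakDerivative

section FormResolvent

variable {V H : Type*} [NormedAddCommGroup V] [InnerProductSpace ℂ V] [CompleteSpace V]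
  [NormedAddCommGroup H] [InnerProductSpace ℂ H] [CompleteSpace H] {J : V →L[ℂ] H}

/-- The solution operator of the variational problem `⟪w, z⟫ = ⟪J w, v⟫` for all `w : V`; it maps
`v` to `J z`. -/
def formResolvent (J : V →L[ℂ] H) : H →L[ℂ] H := J ∘L J.adjoint

theorem formResolvent_eq_iff {v u : H} :
    formResolvent J v = u ↔ ∃ z, J z = u ∧ ∀ w, inner ℂ w z = inner ℂ (J w) v := by
  constructor
  · rintro rfl
    exact ⟨J.adjoint v, rfl, fun w => J.adjoint_inner_right w v⟩
  · rintro ⟨z, rfl, hz⟩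
    have hadjoint : J.adjoint v = z := ext_inner_left ℂ fun w => by
      rw [J.adjoint_inner_right, hz]
    rw [formResolvent, ContinuousLinearMap.comp_apply, hadjoint]

theorem formResolvent_mem_Icc (hJ : ‖J‖ ≤ 1) : formResolvent J ∈ Set.Icc 0 1 := by
  refine CStarAlgebra.mem_Icc_iff_norm_le_one.2
    ⟨(ContinuousLinearMap.nonneg_iff_isPositive _).2 J.isPositive_self_comp_adjoint, ?_⟩
  calc ‖formResolvent J‖ ≤ ‖J‖ * ‖J.adjoint‖ := ContinuousLinearMap.opNorm_comp_le _ _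
    _ = ‖J‖ * ‖J‖ := by rw [LinearIsometryEquiv.norm_map]
    _ ≤ 1 := mul_le_one₀ hJ (norm_nonneg _) hJ

theorem injective_formResolvent (hJ : J.rangeᗮ = ⊥) : Function.Injective (formResolvent J) := by
  refine (LinearMap.ker_eq_bot (f := (formResolvent J).toLinearMap)).1 ?_
  rw [← hJ, ContinuousLinearMap.orthogonal_range]
  exact J.ker_self_comp_adjoint

end FormResolvent

section Sobolev

theorem inner_eq_integral_of_ae_eq_ofReal {α : Type*} [MeasurableSpace α] {μ : Measure α}
    {v w : Lp ℂ 2 μ} {F G : α → ℝ} (hv : v =ᵐ[μ] fun x => (F x : ℂ))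
    (hw : w =ᵐ[μ] fun x => (G x : ℂ)) : inner ℂ v w = ((∫ x, F x * G x ∂μ : ℝ) : ℂ) := by
  rw [L2.inner_def, ← integral_complex_ofReal]
  refine integral_congr_ae ?_
  filter_upwards [hv, hw] with x hvx hwx
  rw [hvx, hwx, RCLike.inner_apply, Complex.conj_ofReal, Complex.ofReal_mul, mul_comm]

theorem re_inner_eq_integral_of_ae_eq_ofReal {α : Type*} [MeasurableSpace α] {μ : Measure α}
    {v : Lp ℂ 2 μ} {F : α → ℝ} (hv : v =ᵐ[μ] fun x => (F x : ℂ)) (w : Lp ℂ 2 μ) :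
    (inner ℂ v w).re = ∫ x, F x * (w x).re ∂μ := by
  rw [L2.inner_def, ← Complex.reCLM_apply,
    ← Complex.reCLM.integral_comp_comm (L2.integrable_inner v w)]
  refine integral_congr_ae ?_
  filter_upwards [hv] with x hx
  rw [hx, RCLike.inner_apply, Complex.conj_ofReal, Complex.reCLM_apply, Complex.re_mul_ofReal,
    mul_comm]

variable {d : ℕ} {Ω : Opens (EuclideanSpace ℝ (Fin d))}

/-- Lebesgue measure on `Ω`. -/
abbrev volumeOn (Ω : Opens (EuclideanSpace ℝ (Fin d))) : Measure (EuclideanSpace ℝ (Fin d)) :=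
  volume.restrict Ω

theorem memLp_testFunction (φ : 𝓓(Ω, ℝ)) : MemLp (fun x => (φ x : ℂ)) 2 (volumeOn Ω) :=
  (φ.continuous.memLp_of_hasCompactSupport φ.hasCompactSupport |>.restrict _).ofReal

/-- A test function as an element of `L²(Ω)`. -/
def testLp (φ : 𝓓(Ω, ℝ)) : L2 Ω := (memLp_testFunction φ).toLp _

theorem coeFn_testLp (φ : 𝓓(Ω, ℝ)) : testLp φ =ᵐ[volumeOn Ω] fun x => (φ x : ℂ) :=
  (memLp_testFunction φ).coeFn_toLp

theorem coeFn_inner_testLp (φ : 𝓓(Ω, ℝ)) (u : L2 Ω) :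
    (fun x => inner ℂ (testLp φ x) (u x)) =ᵐ[volumeOn Ω] fun x => φ x • u x := by
  filter_upwards [coeFn_testLp φ] with x hx
  rw [hx, RCLike.inner_apply, Complex.conj_ofReal, Complex.real_smul, mul_comm]

theorem inner_testLp (φ : 𝓓(Ω, ℝ)) (u : L2 Ω) :
    inner ℂ (testLp φ) u = ∫ x in Ω, φ x • u x := by
  rw [L2.inner_def]
  exact integral_congr_ae (coeFn_inner_testLp φ u)

theorem integrable_testFunction_smul (φ : 𝓓(Ω, ℝ)) (u : L2 Ω) :
    Integrable (fun x => φ x • u x) (volumeOn Ω) :=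
  (L2.integrable_inner (testLp φ) u).congr (coeFn_inner_testLp φ u)

theorem inner_testLp_testLp (φ ψ : 𝓓(Ω, ℝ)) :
    inner ℂ (testLp φ) (testLp ψ) = ((∫ x, φ x * ψ x : ℝ) : ℂ) := by
  rw [inner_eq_integral_of_ae_eq_ofReal (coeFn_testLp φ) (coeFn_testLp ψ)]
  exact congrArg _ (setIntegral_smul_eq_of_tsupport_subset φ.tsupport_subset ψ)

theorem eq_zero_of_forall_inner_testLp {v : L2 Ω} (hv : ∀ φ : 𝓓(Ω, ℝ), inner ℂ (testLp φ) v = 0) :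
    v = 0 := by
  have hloc : LocallyIntegrableOn v (Ω : Set (EuclideanSpace ℝ (Fin d))) volume :=
    locallyIntegrableOn_of_locallyIntegrable_restrict ((Lp.memLp v).locallyIntegrable one_le_two)
  refine Lp.eq_zero_iff_ae_eq_zero.2 ((ae_restrict_iff' Ω.isOpen.measurableSet).2 ?_)
  refine Ω.isOpen.ae_eq_zero_of_integral_contDiff_smul_eq_zero hloc fun φ hφ hφc hφΩ => ?_
  rw [← setIntegral_smul_eq_of_tsupport_subset hφΩ]
  exact (inner_testLp ⟨φ, hφ, hφc, hφΩ⟩ v).symm.trans (hv _)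

theorem isWeakGradient_iff_inner {u : L2 Ω} {g : Fin d → L2 Ω} :
    IsWeakGradient u g ↔
      ∀ (i : Fin d) (φ : 𝓓(Ω, ℝ)), inner ℂ (testLp (pd i φ)) u = -inner ℂ (testLp φ) (g i) := by
  simp only [IsWeakGradient, inner_testLp]

theorem isWeakLaplacian_iff_inner {u f : L2 Ω} :
    IsWeakLaplacian u f ↔
      ∀ φ : 𝓓(Ω, ℝ), ∑ i, inner ℂ (testLp (pd i (pd i φ))) u = inner ℂ (testLp φ) f := by
  refine forall_congr' fun φ => ?_
  simp only [Finset.sum_smul, inner_testLp,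
    integral_finsetSum _ fun i _ => integrable_testFunction_smul (pd i (pd i φ)) u]

theorem normalDerivEqZero_iff_inner {T : Set (L2 Ω × (Fin d → L2 Ω))} {g : Fin d → L2 Ω}
    {f : L2 Ω} :
    NormalDerivEqZero T g f ↔ ∀ w ∈ T, inner ℂ w.1 f + ∑ i, inner ℂ (w.2 i) (g i) = 0 := by
  simp only [L2.inner_def,
    ← integral_finsetSum _ fun _ _ => L2.integrable_inner (𝕜 := ℂ) (_ : L2 Ω) _]
  rfl

theorem isWeakGradient_testLp (φ : 𝓓(Ω, ℝ)) :
    IsWeakGradient (testLp φ) fun i => testLp (pd i φ) := by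
  have hint : ∀ φ ψ : 𝓓(Ω, ℝ), Integrable (fun x => φ x * ψ x) := fun φ ψ =>
    (φ.continuous.mul ψ.continuous).integrable_of_hasCompactSupport φ.hasCompactSupport.mul_right
  have hdiff : ∀ φ : 𝓓(Ω, ℝ), Differentiable ℝ φ := fun φ => φ.contDiff.differentiable (by simp)
  refine isWeakGradient_iff_inner.2 fun i ψ => ?_
  have hparts : ∫ x, φ x * pd i ψ x = -∫ x, pd i φ x * ψ x := by
    simp only [pd_apply]
    refine integral_mul_fderiv_eq_neg_fderiv_mul_of_integrable ?_ ?_ (hint φ ψ)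
      (fun x _ => hdiff φ x) (fun x _ => hdiff ψ x)
    · simpa only [pd_apply] using hint (pd i φ) ψ
    · simpa only [pd_apply] using hint φ (pd i ψ)
  simp only [inner_testLp_testLp, mul_comm (pd i ψ _), mul_comm (ψ _), hparts, Complex.ofReal_neg]

theorem testLp_mem_H1 (φ : 𝓓(Ω, ℝ)) : (testLp φ, fun i => testLp (pd i φ)) ∈ H1 Ω :=
  isWeakGradient_testLp φ

variable (Ω) in
/-- The Hilbert space `L²(Ω) × L²(Ω)^d`. -/
abbrev L2Prod : Type := WithLp 2 (L2 Ω × PiLp 2 fun _ : Fin d => L2 Ω)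

variable (Ω) in
/-- `H¹(Ω)` as a subspace of the Hilbert space `L²(Ω) × L²(Ω)^d`. -/
def sobolev : Submodule ℂ (L2Prod Ω) where
  carrier := {w | IsWeakGradient w.fst fun i => w.snd i}
  zero_mem' := isWeakGradient_iff_inner.2 fun i φ => by simp
  add_mem' {v w} hv hw := isWeakGradient_iff_inner.2 fun i φ => by
    simp only [WithLp.add_fst, WithLp.add_snd, PiLp.add_apply, inner_add_right,
      isWeakGradient_iff_inner.1 hv i φ, isWeakGradient_iff_inner.1 hw i φ, neg_add]
  smul_mem' c w hw := isWeakGradient_iff_inner.2 fun i φ => by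
    simp only [WithLp.smul_fst, WithLp.smul_snd, PiLp.smul_apply, inner_smul_right,
      isWeakGradient_iff_inner.1 hw i φ, mul_neg]

theorem isClosed_sobolev : IsClosed (sobolev Ω : Set (L2Prod Ω)) := by
  have hInter : (sobolev Ω : Set (L2Prod Ω)) = ⋂ (i : Fin d), ⋂ (φ : 𝓓(Ω, ℝ)),
      {w | inner ℂ (testLp (pd i φ)) w.fst = -inner ℂ (testLp φ) (w.snd i)} := by
    ext w
    simp only [Set.mem_iInter]
    exact isWeakGradient_iff_inner
  rw [hInter]
  refine isClosed_iInter fun i => isClosed_iInter fun φ => isClosed_eq ?_ ?_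
  · exact Continuous.inner continuous_const (WithLp.continuous_fst ..)
  · exact (Continuous.inner continuous_const
      ((PiLp.continuous_apply 2 _ i).comp (WithLp.continuous_snd ..))).neg

instance : CompleteSpace (sobolev Ω) := isClosed_sobolev.completeSpace_coe

variable (Ω) in
/-- The inclusion of `H¹(Ω)` in `L²(Ω)`. -/
def sobolevInclusion : sobolev Ω →L[ℂ] L2 Ω :=
  WithLp.fstL 2 ℂ (L2 Ω) (PiLp 2 fun _ : Fin d => L2 Ω) ∘L (sobolev Ω).subtypeL

theorem norm_sobolevInclusion_le : ‖sobolevInclusion Ω‖ ≤ 1 :=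
  ContinuousLinearMap.opNorm_le_bound _ zero_le_one fun w => by
    rw [one_mul]
    exact WithLp.norm_fst_le (p := 2) (α := L2 Ω) (β := PiLp 2 fun _ : Fin d => L2 Ω) w

theorem orthogonal_range_sobolevInclusion : (sobolevInclusion Ω).rangeᗮ = ⊥ := by
  refine (Submodule.eq_bot_iff _).2 fun v hv => eq_zero_of_forall_inner_testLp fun φ => ?_
  refine (Submodule.mem_orthogonal _ _).1 hv _ ⟨⟨WithLp.toLp 2
    (testLp φ, WithLp.toLp 2 fun i => testLp (pd i φ)), testLp_mem_H1 φ⟩, rfl⟩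

variable (Ω) in
/-- The resolvent `(1 - Δ)⁻¹` of the Neumann Laplacian. -/
def neumannResolvent : L2 Ω →L[ℂ] L2 Ω :=
  formResolvent (V := sobolev Ω) (sobolevInclusion Ω)

theorem neumannResolvent_mem_Icc : neumannResolvent Ω ∈ Set.Icc 0 1 :=
  formResolvent_mem_Icc norm_sobolevInclusion_le

theorem injective_neumannResolvent : Function.Injective (neumannResolvent Ω) :=
  injective_formResolvent orthogonal_range_sobolevInclusion

theorem neumannResolvent_eq_iff {v u : L2 Ω} :
    neumannResolvent Ω v = u ↔ ∃ g : Fin d → L2 Ω, IsWeakGradient u g ∧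
      ∀ w ∈ H1 Ω, inner ℂ w.1 u + ∑ i, inner ℂ (w.2 i) (g i) = inner ℂ w.1 v := by
  have hinner : ∀ w z : sobolev Ω, inner ℂ w z =
      inner ℂ w.1.fst z.1.fst + ∑ i, inner ℂ (w.1.snd i) (z.1.snd i) := fun w z => by
    rw [Submodule.coe_inner, WithLp.prod_inner_apply, PiLp.inner_apply]
    rfl
  rw [neumannResolvent, formResolvent_eq_iff]
  simp only [hinner]
  constructor
  · rintro ⟨z, rfl, hz⟩
    exact ⟨fun i => z.1.snd i, z.2, fun w hw =>
      hz ⟨WithLp.toLp 2 (w.1, WithLp.toLp 2 w.2), hw⟩⟩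
  · rintro ⟨g, hg, hz⟩
    exact ⟨⟨WithLp.toLp 2 (u, WithLp.toLp 2 g), hg⟩, rfl, fun w =>
      hz (w.1.fst, fun i => w.1.snd i) w.2⟩

theorem isWeakLaplacian_of_normalDerivEqZero {u f : L2 Ω} {g : Fin d → L2 Ω}
    (hg : IsWeakGradient u g) (hf : NormalDerivEqZero (H1 Ω) g f) : IsWeakLaplacian u f := by
  refine isWeakLaplacian_iff_inner.2 fun φ => ?_
  simp only [fun i => isWeakGradient_iff_inner.1 hg i (pd i φ), Finset.sum_neg_distrib]
  exact (eq_neg_of_add_eq_zero_left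
    (normalDerivEqZero_iff_inner.1 hf _ (testLp_mem_H1 φ))).symm

variable (Ω) in
theorem isResolventAtOne_neumannResolvent :
    IsResolventAtOne (neumannResolvent Ω) (neumannLaplacian Ω) := by
  intro u f
  have hgreen : ∀ g : Fin d → L2 Ω, NormalDerivEqZero (H1 Ω) g f ↔ ∀ w ∈ H1 Ω,
      inner ℂ w.1 u + ∑ i, inner ℂ (w.2 i) (g i) = inner ℂ w.1 (u - f) := fun g => by
    refine normalDerivEqZero_iff_inner.trans (forall₂_congr fun w _ => ?_)
    rw [inner_sub_right, sub_eq_add_neg, add_right_inj, eq_neg_iff_add_eq_zero, add_comm]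
  rw [neumannResolvent_eq_iff]
  refine exists_congr fun g => and_congr_right fun hg => ?_
  rw [← hgreen]
  exact and_iff_right_of_imp (isWeakLaplacian_of_normalDerivEqZero hg)

theorem normalDerivEqZero_closure {T : Set (L2 Ω × (Fin d → L2 Ω))} {g : Fin d → L2 Ω}
    {f : L2 Ω} (h : NormalDerivEqZero T g f) : NormalDerivEqZero (closure T) g f := by
  rw [normalDerivEqZero_iff_inner] at h ⊢
  have hclosed : IsClosed {w : L2 Ω × (Fin d → L2 Ω) |
      inner ℂ w.1 f + ∑ i, inner ℂ (w.2 i) (g i) = 0} :=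
    isClosed_eq (by fun_prop) continuous_const
  exact closure_minimal h hclosed

theorem neumannGraph_eq_neumannLaplacian {T : Set (L2 Ω × (Fin d → L2 Ω))} (hT : T ⊆ H1 Ω)
    (hd : H1 Ω ⊆ closure T) : neumannGraph T = neumannLaplacian Ω := by
  refine Set.Subset.antisymm ?_ ?_
  · rintro _ ⟨g, hg, hΔ, hν⟩
    exact ⟨g, hg, hΔ, fun w hw => normalDerivEqZero_closure hν w (hd hw)⟩
  · rintro _ ⟨g, hg, hΔ, hν⟩
    exact ⟨g, hg, hΔ, fun w hw => hν w (hT hw)⟩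

end Sobolev

section Truncation

/-- A smooth increasing function that vanishes exactly on `(-∞, M]` and is constant on
`[M + 1, ∞)`. -/
def smoothTruncation (M r : ℝ) : ℝ := Real.smoothTransition (r - M)

theorem contDiff_smoothTruncation (M : ℝ) {n : ℕ∞} : ContDiff ℝ n (smoothTruncation M) :=
  Real.smoothTransition.contDiff.comp (contDiff_id.sub contDiff_const)

theorem monotone_smoothTruncation (M : ℝ) : Monotone (smoothTruncation M) := fun _ _ h =>
  Real.smoothTransition.monotone (sub_le_sub_right h M)

theorem smoothTruncation_nonneg (M r : ℝ) : 0 ≤ smoothTruncation M r :=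
  Real.smoothTransition.nonneg _

theorem smoothTruncation_of_le {M r : ℝ} (h : r ≤ M) : smoothTruncation M r = 0 :=
  Real.smoothTransition.zero_of_nonpos (sub_nonpos.2 h)

theorem smoothTruncation_mul_sub_nonneg (M r : ℝ) : 0 ≤ smoothTruncation M r * (r - M) := by
  rcases le_total r M with h | h
  · rw [smoothTruncation_of_le h, zero_mul]
  · exact mul_nonneg (smoothTruncation_nonneg M r) (sub_nonneg.2 h)

theorem le_of_smoothTruncation_mul_sub_eq_zero {M r : ℝ}
    (h : smoothTruncation M r * (r - M) = 0) : r ≤ M := by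
  by_contra! hr
  exact (mul_pos (Real.smoothTransition.pos_of_pos (sub_pos.2 hr)) (sub_pos.2 hr)).ne' h

theorem hasCompactSupport_deriv_smoothTruncation (M : ℝ) :
    HasCompactSupport (deriv (smoothTruncation M)) := by
  refine HasCompactSupport.intro (isCompact_Icc (a := M) (b := M + 1)) fun r hr => ?_
  rw [Set.mem_Icc, not_and_or, not_le, not_le] at hr
  rcases hr with hr | hr
  · have hzero : smoothTruncation M =ᶠ[𝓝 r] fun _ => 0 := by
      filter_upwards [Iio_mem_nhds hr] with x hx
      exact smoothTruncation_of_le (Set.mem_Iio.1 hx).le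
    rw [hzero.deriv_eq, deriv_const]
  · have hone : smoothTruncation M =ᶠ[𝓝 r] fun _ => 1 := by
      filter_upwards [Ioi_mem_nhds hr] with x hx
      exact Real.smoothTransition.one_of_one_le (le_sub_iff_add_le'.2 (Set.mem_Ioi.1 hx).le)
    rw [hone.deriv_eq, deriv_const]

theorem exists_lipschitzWith_smoothTruncation (M : ℝ) :
    ∃ B, LipschitzWith B (smoothTruncation M) := by
  obtain ⟨B, hB⟩ := ((contDiff_smoothTruncation M (n := 1)).continuous_deriv
    (by simp)).bounded_above_of_compact_support (hasCompactSupport_deriv_smoothTruncation M)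
  exact ⟨B.toNNReal, lipschitzWith_of_nnnorm_deriv_le
    ((contDiff_smoothTruncation M (n := 1)).differentiable (by simp)) fun r =>
      NNReal.le_toNNReal_of_coe_le (hB r)⟩

theorem exists_lipschitzWith_deriv_smoothTruncation (M : ℝ) :
    ∃ C, LipschitzWith C (deriv (smoothTruncation M)) :=
  ContDiff.lipschitzWith_of_hasCompactSupport (𝕂 := ℝ) (n := 1)
    (hasCompactSupport_deriv_smoothTruncation M)
    ((contDiff_smoothTruncation M (n := 2)).iterate_deriv' 1 1) (by simp)

theorem ae_le_of_integral_smoothTruncation_mul_nonpos {α : Type*} [MeasurableSpace α]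
    {μ : Measure α} {p q : α → ℝ} (hp : MemLp p 2 μ) (hq : MemLp q 2 μ) {M h : ℝ} (hM : 0 ≤ M)
    (hh : 0 ≤ h) (hle : ∀ᵐ x ∂μ, p x - h * q x ≤ M)
    (hnonpos : ∫ x, smoothTruncation M (p x) * q x ∂μ ≤ 0) : ∀ᵐ x ∂μ, p x ≤ M := by
  obtain ⟨B, hB⟩ := exists_lipschitzWith_smoothTruncation M
  have hTp : MemLp (fun x => smoothTruncation M (p x)) 2 μ :=
    hB.comp_memLp (smoothTruncation_of_le hM) hp
  have hint : Integrable (fun x => smoothTruncation M (p x) * (p x - M)) μ := by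
    refine (hTp.integrable_mul hp).mono' (hTp.aestronglyMeasurable.mul
      (hp.aestronglyMeasurable.sub aestronglyMeasurable_const)) (.of_forall fun x => ?_)
    rw [Real.norm_of_nonneg (smoothTruncation_mul_sub_nonneg M _)]
    exact mul_le_mul_of_nonneg_left (sub_le_self _ hM) (smoothTruncation_nonneg M _)
  have hzero : ∫ x, smoothTruncation M (p x) * (p x - M) ∂μ = 0 := by
    refine le_antisymm ?_ (integral_nonneg fun x => smoothTruncation_mul_sub_nonneg M _)
    calc ∫ x, smoothTruncation M (p x) * (p x - M) ∂μ
        ≤ ∫ x, h * (smoothTruncation M (p x) * q x) ∂μ := by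
          refine integral_mono_ae hint ((hTp.integrable_mul hq).const_mul h) ?_
          filter_upwards [hle] with x hx
          rw [mul_left_comm]
          exact mul_le_mul_of_nonneg_left (by linarith) (smoothTruncation_nonneg M _)
      _ = h * ∫ x, smoothTruncation M (p x) * q x ∂μ := integral_const_mul _ _
      _ ≤ 0 := mul_nonpos_of_nonneg_of_nonpos hh hnonpos
  filter_upwards [(integral_eq_zero_iff_of_nonneg
    (fun x => smoothTruncation_mul_sub_nonneg M _) hint).1 hzero] with x hx
  exact le_of_smoothTruncation_mul_sub_eq_zero hx

end Truncation

section Stampacchia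

variable {d : ℕ} {Ω : Opens (EuclideanSpace ℝ (Fin d))} {u f : L2 Ω} {g : Fin d → L2 Ω}

theorem IsWeakGradient.hasWeakDirDeriv_re (h : IsWeakGradient u g) (i : Fin d) :
    HasWeakDirDeriv volume Ω (EuclideanSpace.single i 1) (fun x => (u x).re)
      (fun x => (g i x).re) := by
  intro φ hφ hφc hφΩ
  have hre := congrArg Complex.re (isWeakGradient_iff_inner.1 h i ⟨φ, hφ, hφc, hφΩ⟩)
  rw [Complex.neg_re, re_inner_eq_integral_of_ae_eq_ofReal (coeFn_testLp _),
    re_inner_eq_integral_of_ae_eq_ofReal (coeFn_testLp _)] at hre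
  simp only [pd_apply, mul_comm _ (Complex.re _)] at hre
  exact hre

theorem isWeakGradient_of_hasWeakDirDeriv {p : EuclideanSpace ℝ (Fin d) → ℝ}
    {q : Fin d → EuclideanSpace ℝ (Fin d) → ℝ}
    (h : ∀ i, HasWeakDirDeriv volume Ω (EuclideanSpace.single i 1) p (q i))
    (hu : u =ᵐ[volumeOn Ω] fun x => (p x : ℂ))
    (hg : ∀ i, g i =ᵐ[volumeOn Ω] fun x => (q i x : ℂ)) : IsWeakGradient u g := by
  refine isWeakGradient_iff_inner.2 fun i φ => ?_
  have hweak := h i φ φ.contDiff φ.hasCompactSupport φ.tsupport_subset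
  simp only [← pd_apply, mul_comm (p _), mul_comm (q i _)] at hweak
  rw [inner_eq_integral_of_ae_eq_ofReal (coeFn_testLp _) hu,
    inner_eq_integral_of_ae_eq_ofReal (coeFn_testLp _) (hg i), hweak, Complex.ofReal_neg]

theorem integral_comp_re_mul_re_nonpos (huf : (u, f) ∈ neumannLaplacian Ω) {G : ℝ → ℝ} {B C : ℝ≥0}
    (hG : Differentiable ℝ G) (hGB : LipschitzWith B G) (hGC : LipschitzWith C (deriv G))
    (hmono : Monotone G) (h0 : G 0 = 0) : ∫ x in Ω, G (u x).re * (f x).re ≤ 0 := by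
  obtain ⟨g, hg, -, hgreen⟩ := huf
  have hre : ∀ v : L2 Ω, MemLp (fun x => (v x).re) 2 (volumeOn Ω) := fun v => (Lp.memLp v).re
  have hv : MemLp (fun x => (G (u x).re : ℂ)) 2 (volumeOn Ω) :=
    (hGB.comp_memLp h0 (hre u)).ofReal
  have hk : ∀ i, MemLp (fun x => ((deriv G (u x).re * (g i x).re : ℝ) : ℂ)) 2 (volumeOn Ω) :=
    fun i => (memLp_deriv_comp_mul hGB hGC.continuous (hre u).aestronglyMeasurable
      (hre (g i))).ofReal
  have hvk : IsWeakGradient (hv.toLp _) fun i => (hk i).toLp _ :=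
    isWeakGradient_of_hasWeakDirDeriv (fun i => (hg.hasWeakDirDeriv_re i).comp Ω.isOpen (hre u)
      (hre (g i)) hG hGB hGC) hv.coeFn_toLp fun i => (hk i).coeFn_toLp
  have henergy : ∀ i, 0 ≤ (inner ℂ ((hk i).toLp _) (g i)).re := fun i => by
    rw [re_inner_eq_integral_of_ae_eq_ofReal (hk i).coeFn_toLp]
    refine integral_nonneg fun x => ?_
    rw [mul_assoc]
    exact mul_nonneg hmono.deriv_nonneg (mul_self_nonneg _)
  have hsum : inner ℂ (hv.toLp _) f + ∑ i, inner ℂ ((hk i).toLp _) (g i) = 0 :=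
    normalDerivEqZero_iff_inner.1 hgreen (hv.toLp _, fun i => (hk i).toLp _) hvk
  have hre_sum := congrArg Complex.re hsum
  rw [Complex.add_re, Complex.re_sum, Complex.zero_re,
    re_inner_eq_integral_of_ae_eq_ofReal hv.coeFn_toLp] at hre_sum
  linarith [Finset.sum_nonneg fun i (_ : i ∈ Finset.univ) => henergy i]

theorem ae_re_le_of_ae_re_sub_smul_le (huf : (u, f) ∈ neumannLaplacian Ω) {h M : ℝ} (hh : 0 ≤ h)
    (hM : 0 ≤ M) (hle : ∀ᵐ x ∂volumeOn Ω, (u x).re - h * (f x).re ≤ M) :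
    ∀ᵐ x ∂volumeOn Ω, (u x).re ≤ M := by
  obtain ⟨B, hB⟩ := exists_lipschitzWith_smoothTruncation M
  obtain ⟨C, hC⟩ := exists_lipschitzWith_deriv_smoothTruncation M
  exact ae_le_of_integral_smoothTruncation_mul_nonpos (Lp.memLp u).re (Lp.memLp f).re hM hh hle
    (integral_comp_re_mul_re_nonpos huf ((contDiff_smoothTruncation M (n := 1)).differentiable
      (by simp)) hB hC (monotone_smoothTruncation M) (smoothTruncation_of_le hM))

end Stampacchia

section HalfPlane

variable {X : Type*} [MeasurableSpace X] {μ : Measure X}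

/-- The `L²`-functions with values in the half-plane `{z | Re (c z) ≤ M}`. -/
def halfPlaneSet (μ : Measure X) (c : ℂ) (M : ℝ) : Set (Lp ℂ 2 μ) :=
  {f | ∀ᵐ x ∂μ, (c * f x).re ≤ M}

theorem isClosed_halfPlaneSet (c : ℂ) (M : ℝ) : IsClosed (halfPlaneSet μ c M) := by
  refine IsSeqClosed.isClosed fun f f₀ hf hlim => ?_
  obtain ⟨ns, -, hns⟩ := (tendstoInMeasure_of_tendsto_Lp hlim).exists_seq_tendsto_ae
  have hall : ∀ᵐ x ∂μ, ∀ n, (c * f n x).re ≤ M := ae_all_iff.2 hf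
  filter_upwards [hns, hall] with x hx hfx
  have hcont : Continuous fun z : ℂ => (c * z).re := by fun_prop
  exact le_of_tendsto ((hcont.tendsto _).comp hx) (.of_forall fun n => hfx _)

theorem isNonneg_iff_mem_halfPlaneSet {f : Lp ℂ 2 μ} :
    IsNonneg f ↔ f ∈ halfPlaneSet μ (-1) 0 ∧ f ∈ halfPlaneSet μ Complex.I 0 ∧
      f ∈ halfPlaneSet μ (-Complex.I) 0 := by
  simp only [IsNonneg, halfPlaneSet, Set.mem_ofPred_eq, ← eventually_and]
  refine eventually_congr (.of_forall fun x => ?_)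
  simp only [neg_mul, one_mul, Complex.neg_re, Complex.I_mul_re, neg_neg, Left.neg_nonpos_iff]
  exact and_congr_right fun _ => ⟨fun h => ⟨h.ge, h.le⟩, fun h => le_antisymm h.2 h.1⟩

theorem norm_le_of_forall_dense_re_mul_le {z : ℂ} {K : ℝ} {s : Set ℂ} (hs : Dense s)
    (h : ∀ c ∈ s, (c * z).re ≤ K * ‖c‖) : ‖z‖ ≤ K := by
  have hclosed : IsClosed {c : ℂ | (c * z).re ≤ K * ‖c‖} := isClosed_le (by fun_prop) (by fun_prop)
  have hall : ∀ c : ℂ, (c * z).re ≤ K * ‖c‖ := fun c => closure_minimal h hclosed (hs c)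
  rcases eq_or_ne z 0 with rfl | hz
  · simpa using hall 1
  · refine le_of_mul_le_mul_right ?_ (norm_pos_iff.2 hz)
    calc ‖z‖ * ‖z‖ = (conj z * z).re := by
          rw [← Complex.normSq_eq_conj_mul_self, Complex.ofReal_re, Complex.normSq_eq_norm_sq, sq]
      _ ≤ K * ‖conj z‖ := hall _
      _ = K * ‖z‖ := by rw [Complex.norm_conj]

theorem eLpNorm_top_le_ofReal_iff {f : Lp ℂ 2 μ} {K : ℝ} (hK : 0 ≤ K) :
    eLpNorm f ∞ μ ≤ ENNReal.ofReal K ↔ ∀ c : ℂ, f ∈ halfPlaneSet μ c (K * ‖c‖) := by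
  rw [eLpNorm_exponent_top]
  constructor
  · intro hf c
    filter_upwards [ae_le_eLpNormEssSup (f := f) (μ := μ)] with x hx
    have hx' : ‖f x‖ ≤ K := by
      rw [← ENNReal.ofReal_le_ofReal_iff hK, ofReal_norm]
      exact hx.trans hf
    calc (c * f x).re ≤ ‖c * f x‖ := Complex.re_le_norm _
      _ = ‖f x‖ * ‖c‖ := by rw [norm_mul, mul_comm]
      _ ≤ K * ‖c‖ := mul_le_mul_of_nonneg_right hx' (norm_nonneg c)
  · intro hf
    refine eLpNormEssSup_le_of_ae_bound ?_
    filter_upwards [ae_all_iff.2 fun n => hf (denseSeq ℂ n)] with x hx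
    exact norm_le_of_forall_dense_re_mul_le (denseRange_denseSeq ℂ) (Set.forall_mem_range.2 hx)

theorem isSubmarkovian_of_mapsTo_halfPlaneSet {S : ℝ≥0 → Lp ℂ 2 μ →L[ℂ] Lp ℂ 2 μ}
    (hS : ∀ t, 0 < t → ∀ (c : ℂ) (M : ℝ), 0 ≤ M →
      Set.MapsTo (S t) (halfPlaneSet μ c M) (halfPlaneSet μ c M)) : IsSubmarkovian S := by
  refine ⟨fun t ht f hf => ?_, fun t ht f hf => ?_⟩
  · rw [isNonneg_iff_mem_halfPlaneSet] at hf ⊢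
    exact ⟨hS t ht _ _ le_rfl hf.1, hS t ht _ _ le_rfl hf.2.1, hS t ht _ _ le_rfl hf.2.2⟩
  · rw [← ENNReal.ofReal_toReal hf.eLpNorm_ne_top, eLpNorm_top_le_ofReal_iff ENNReal.toReal_nonneg]
    exact fun c => hS t ht c _ (by positivity) ((eLpNorm_top_le_ofReal_iff
      ENNReal.toReal_nonneg).1 (ENNReal.ofReal_toReal hf.eLpNorm_ne_top).ge c)

end HalfPlane

section Generation

variable {d : ℕ} {Ω : Opens (EuclideanSpace ℝ (Fin d))}

theorem mem_halfPlaneSet_of_sub_smul_mem {u f : L2 Ω} (huf : (u, f) ∈ neumannLaplacian Ω) {c : ℂ}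
    {h M : ℝ} (hh : 0 ≤ h) (hM : 0 ≤ M) (hmem : u - h • f ∈ halfPlaneSet (volumeOn Ω) c M) :
    u ∈ halfPlaneSet (volumeOn Ω) c M := by
  have hcuf : (c • u, c • f) ∈ neumannLaplacian Ω := by
    rw [isResolventAtOne_neumannResolvent Ω, ← smul_sub, map_smul,
      (isResolventAtOne_neumannResolvent Ω u f).1 huf]
  have hle : ∀ᵐ x ∂volumeOn Ω, ((c • u) x).re - h * ((c • f) x).re ≤ M := by
    filter_upwards [hmem, Lp.coeFn_smul c u, Lp.coeFn_smul c f, Lp.coeFn_sub u (h • f),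
      Lp.coeFn_smul h f] with x hx hcu hcf hsub hhf
    rw [hsub, Pi.sub_apply, hhf, Pi.smul_apply, mul_sub, mul_smul_comm, Complex.sub_re,
      Complex.smul_re] at hx
    rwa [hcu, hcf]
  filter_upwards [ae_re_le_of_ae_re_sub_smul_le hcuf hh hM hle, Lp.coeFn_smul c u] with x hx hcu
  rwa [hcu] at hx

variable (Ω) in
theorem generatesSubmarkovianC0Semigroup_neumannLaplacian :
    GeneratesSubmarkovianC0Semigroup (neumannLaplacian Ω) := by
  have hR := neumannResolvent_mem_Icc (Ω := Ω)
  have hinj := injective_neumannResolvent (Ω := Ω)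
  have hA := isResolventAtOne_neumannResolvent Ω
  refine ⟨cfcSemigroup (neumannResolvent Ω), isC0Semigroup_cfcSemigroup hR hinj,
    isGenerator_cfcSemigroup hR hinj hA,
    isSubmarkovian_of_mapsTo_halfPlaneSet fun t ht c M hM f hf => ?_⟩
  exact cfcSemigroup_mem_of_isClosed hR hinj hA (isClosed_halfPlaneSet c M)
    (fun h hh u f huf => mem_halfPlaneSet_of_sub_smul_mem huf hh.le hM) ht hf

end Generation

end NeumannLap

end

theorem proposition6p1_general {d : ℕ} (Ω : Opens (EuclideanSpace ℝ (Fin d)))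
    {T : Set (NeumannLap.L2 Ω × (Fin d → NeumannLap.L2 Ω))} (hT : T ⊆ NeumannLap.H1 Ω)
    (hd : NeumannLap.H1 Ω ⊆ closure T) :
    NeumannLap.GeneratesSubmarkovianC0Semigroup (NeumannLap.neumannGraph T) := by
  rw [NeumannLap.neumannGraph_eq_neumannLaplacian hT hd]
  exact NeumannLap.generatesSubmarkovianC0Semigroup_neumannLaplacian Ω

theorem proposition6p1 (d : ℕ) (Ω : Opens (EuclideanSpace ℝ (Fin d)))
    (hΩ : Bornology.IsBounded (Ω : Set (EuclideanSpace ℝ (Fin d)))) :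
    NeumannLap.GeneratesSubmarkovianC0Semigroup (NeumannLap.neumannLaplacian Ω) ∧
    (NeumannLap.H1 Ω ⊆ closure (NeumannLap.H1Cont Ω) →
      NeumannLap.GeneratesSubmarkovianC0Semigroup (NeumannLap.neumannLaplacianCont Ω)) :=
  ⟨proposition6p1_general Ω subset_rfl subset_closure,
    fun h => proposition6p1_general Ω (fun _ hw => hw.1) h⟩
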